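/- Let $K$ be a number field of degree $k=[K:\mathbb{Q}]$ with ring of integers $\mathfrak{o}$, let $\mathcal{P}_K$ be the set of non-zero prime ideals of $\mathfrak{o}$, and put $N(\mathfrak{p})=|\mathfrak{o}/\mathfrak{p}|$. For an integral basis $\mathbb{E}=\{e_1,\dots,e_k\}$ of $\mathfrak{o}$ and $H\in\mathbb{N}$ let $O(H,\mathbb{E})=\{\sum_{j=1}^k a_je_j : a_j\in[-H,H)\cap\mathbb{Z}\}$. A set $T\subseteq\mathfrak{o}^n$ is said to have density $\rho(T)$ if for every integral basis $\mathbb{E}$ the limit $$\lim_{H\to\infty}\frac{|T\cap O(H,\mathbb{E})^n|}{(2H)^{nk}}$$ exists and equals $\rho(T)$. A polynomial $f=a_0+a_1x+\dots+a_dx^d\in\mathfrak{o}[x]$ of degree $d$ (not necessarily monic) is $\mathfrak{p}$-Eisenstein if $a_d\notin\mathfrak{p}$, $a_i\in\mathfrak{p}$ for $0\le i\le d-1$, and $a_0\notin\mathfrak{p}^2$; it is shifted Eisenstein if there are $\mathfrak{p}\in\mathcal{P}_K$ and $b\in\mathfrak{o}$ such that $f(x+b)$ is $\mathfrak{p}$-Eisenstein.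 Let $\widetilde{\Gamma}^d\subseteq\mathfrak{o}^{d+1}$ be the set of coefficient tuples $(a_0,\dots,a_d)$ of shifted Eisenstein polynomials of degree $d$. Then for every integer $d\ge 2$ the product below converges unconditionally (its value may be $0$), the density of $\widetilde{\Gamma}^d$ exists, and $$\rho(\widetilde{\Gamma}^d)=1-\prod_{\mathfrak{p}\in\mathcal{P}_K}\left(1-\frac{(N(\mathfrak{p})-1)^2}{N(\mathfrak{p})^{d+1}}\right).$$ For $d=2$ this density is $1$. -/

import Mathlib

open Polynomial NumberField

namespace EisensteinDensity

/-- The box `O(H, 𝔼)` of a number field: the algebraic integers `∑ j, a j • e j` whose coordinates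
`a j` in the integral basis `𝔼 = {e 1, …, e k}` are integers in `[-H, H)`. -/
def box {K : Type*} [Field K] [NumberField K]
    (E : Module.Basis (Fin (Module.finrank ℚ K)) ℤ (𝓞 K)) (H : ℕ) : Set (𝓞 K) :=
  {x | ∀ j, E.repr x j ∈ Set.Ico (-(H : ℤ)) (H : ℤ)}

/-- `T ⊆ 𝔬 ^ n` has density `ρ` with respect to the integral basis `𝔼`:
`|T ∩ O(H, 𝔼) ^ n| / (2 H) ^ (n k) → ρ` as `H → ∞`, where `k = [K : ℚ]`. -/
def HasDensityWrt {K : Type*} [Field K] [NumberField K]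
    (E : Module.Basis (Fin (Module.finrank ℚ K)) ℤ (𝓞 K)) {n : ℕ}
    (T : Set (Fin n → 𝓞 K)) (ρ : ℝ) : Prop :=
  Filter.Tendsto
    (fun H : ℕ =>
      ((T ∩ {a | ∀ i, a i ∈ box E H}).ncard : ℝ) / (2 * (H : ℝ)) ^ (n * Module.finrank ℚ K))
    Filter.atTop (nhds ρ)

/-- `T ⊆ 𝔬 ^ n` has density `ρ`: the density with respect to every integral basis exists
and equals `ρ`. -/
def HasDensity {K : Type*} [Field K] [NumberField K] {n : ℕ}
    (T : Set (Fin n → 𝓞 K)) (ρ : ℝ) : Prop :=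
  ∀ E : Module.Basis (Fin (Module.finrank ℚ K)) ℤ (𝓞 K), HasDensityWrt E T ρ

/-- The polynomial `a 0 + a 1 X + ⋯ + a d X ^ d` represented by the tuple `(a 0, …, a d)`. -/
noncomputable def toPoly {R : Type*} [CommRing R] {d : ℕ} (a : Fin (d + 1) → R) : R[X] :=
  ∑ i, C (a i) * X ^ (i : ℕ)

/-- `f` is shifted `𝔭`-Eisenstein: `f (X + b)` is `𝔭`-Eisenstein for some `b`. -/
def IsShiftedEisensteinAt {R : Type*} [CommRing R] (f : R[X]) (P : Ideal R) : Prop :=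
  ∃ b : R, (f.comp (X + C b)).IsEisensteinAt P

/-- The set of (coefficient tuples of) shifted Eisenstein polynomials of degree `d`: those of degree
exactly `d` which are shifted `𝔭`-Eisenstein for some non-zero prime ideal `𝔭`. The leading
coefficient is not required to be `1`. -/
def shiftedEisenstein (K : Type*) [Field K] [NumberField K] (d : ℕ) :
    Set (Fin (d + 1) → 𝓞 K) :=
  {a | (toPoly a).natDegree = d ∧
    ∃ P : Ideal (𝓞 K), P.IsPrime ∧ P ≠ ⊥ ∧ IsShiftedEisensteinAt (toPoly a) P}

end EisensteinDensity

/-!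
Being shifted `𝔭`-Eisenstein is a condition on the coefficients modulo `𝔭 ^ 2`. By the Chinese
remainder theorem these conditions are independent at distinct primes, so that the set of tuples
which fail it at each of finitely many `𝔭` has density
`∏ (1 - (N(𝔭) - 1) ^ 2 / N(𝔭) ^ (d + 1))`. The local factor is a count modulo `𝔭 ^ 2`: a shift
preserves the `𝔭`-Eisenstein tuples if it lies in `𝔭`, and moves each of them out of that set
otherwise, so there are `N(𝔭)` disjoint translates.

For `d = 2` the finite products already tend to `0`, since `∑ 1 / N(𝔭)` diverges. For `d ≥ 3` the
contribution of the remaining primes has to be small uniformly in `H`. Modulo `𝔭` a shifted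
Eisenstein polynomial is `u (X + c) ^ d`, which leaves `N(𝔭) ^ 2` of the `N(𝔭) ^ (d + 1)` tuples.
If `𝔭` contains a non-zero integer of absolute value at most `2 H`, no residue class receives more
than a constant times its share of the box, so the contribution is `O(1 / N(𝔭) ^ 2)`. For the
other primes, `u (X + c) ^ d` forces the quadratic form `leadingDisc` in the three leading
coefficients into `𝔭`. When its value is non-zero, its norm is `O(H ^ (2 k))`, which allows only
boundedly many such `𝔭`, each of them of norm at least `2 H`, and each of them determines the
constant term modulo `𝔭`. When the value vanishes, one coefficient is determined by the others.
Either way a proportion `O(1 / H)` of the box is left.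
-/

namespace EisensteinDensity

section Proportion

variable {α : Type*} {s : Finset α} {T U : Set α}

/-- The proportion of the elements of the finite set `s` that lie in `T`; it is `0` for `s = ∅`. -/
noncomputable def proportion (s : Finset α) (T : Set α) : ℝ :=
  (T ∩ s).ncard / s.card

theorem proportion_mono (h : ∀ a ∈ s, a ∈ T → a ∈ U) : proportion s T ≤ proportion s U := by
  unfold proportion
  gcongr ?_ / _
  refine Nat.cast_le.2 (Set.ncard_le_ncard ?_ ?_)
  exacts [fun a ha => ⟨h a ha.2 ha.1, ha.2⟩, s.finite_toSet.inter_of_right U]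

theorem proportion_empty : proportion s ∅ = 0 := by
  simp [proportion]

theorem proportion_nonneg : 0 ≤ proportion s T := by
  unfold proportion; positivity

theorem proportion_union_le : proportion s (T ∪ U) ≤ proportion s T + proportion s U := by
  unfold proportion
  rw [← add_div, ← Nat.cast_add, Set.union_inter_distrib_right]
  gcongr
  exact Set.ncard_union_le _ _

theorem ncard_inter_le_of_proportion_le {c : ℝ} (h : proportion s T ≤ c) :
    ((T ∩ s).ncard : ℝ) ≤ c * s.card := by
  rcases s.eq_empty_or_nonempty with rfl | hs
  · simp
  · rwa [proportion, div_le_iff₀ (by exact_mod_cast hs.card_pos)] at h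

theorem proportion_biUnion_le {ι : Type*} (A : Finset ι) (L : ι → Set α) :
    proportion s (⋃ i ∈ A, L i) ≤ ∑ i ∈ A, proportion s (L i) := by
  classical
  induction A using Finset.induction_on with
  | empty => simp [proportion_empty]
  | insert i A hi ih =>
    rw [Finset.set_biUnion_insert, Finset.sum_insert hi]
    exact proportion_union_le.trans (by gcongr)

theorem proportion_iUnion_le_tsum {ι : Type*} {L : ι → Set α} {g : ι → ℝ} (hg : Summable g)
    (h : ∀ i, proportion s (L i) ≤ g i) : proportion s (⋃ i, L i) ≤ ∑' i, g i := by
  classical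
  have hmem : ∀ a : {a // a ∈ s ∧ a ∈ ⋃ i, L i}, ∃ i, a.1 ∈ L i := fun a => Set.mem_iUnion.1 a.2.2
  choose i hi using hmem
  have : Finite {a // a ∈ s ∧ a ∈ ⋃ i, L i} := (s.finite_toSet.inter_of_left _).to_subtype
  let A : Finset ι := (Set.finite_range i).toFinset
  calc proportion s (⋃ i, L i)
      ≤ proportion s (⋃ i ∈ A, L i) := proportion_mono fun a ha haL =>
        Set.mem_biUnion ((Set.finite_range i).mem_toFinset.2 ⟨⟨a, ha, haL⟩, rfl⟩) (hi _)
    _ ≤ ∑ i ∈ A, proportion s (L i) := proportion_biUnion_le A L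
    _ ≤ ∑ i ∈ A, g i := Finset.sum_le_sum fun i _ => h i
    _ ≤ ∑' i, g i := hg.sum_le_tsum A fun i _ => proportion_nonneg.trans (h i)

theorem proportion_compl (hs : s.Nonempty) : proportion s Tᶜ = 1 - proportion s T := by
  have hs' : (s.card : ℝ) ≠ 0 := by exact_mod_cast hs.card_ne_zero
  rw [proportion, proportion, eq_sub_iff_add_eq', ← add_div, div_eq_one_iff_eq hs',
    Set.inter_comm T, Set.inter_comm Tᶜ, ← Set.sdiff_eq]
  exact_mod_cast (Set.ncard_inter_add_ncard_sdiff_eq_ncard _ T).trans (Set.ncard_coe_finset s)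

end Proportion

section Sieve

open Filter Topology

variable {α ι : Type*} {B : ℕ → Finset α} {L : ι → Set α} {f : ι → ℝ} {p : ℝ}

theorem tendsto_proportion_compl_iff (hB : ∀ᶠ H in atTop, (B H).Nonempty) {T : Set α} {ρ : ℝ} :
    Tendsto (fun H => proportion (B H) Tᶜ) atTop (𝓝 (1 - ρ)) ↔
      Tendsto (fun H => proportion (B H) T) atTop (𝓝 ρ) := by
  have h : (fun H => proportion (B H) Tᶜ) =ᶠ[atTop] fun H => 1 - proportion (B H) T :=
    hB.mono fun H hH => proportion_compl hH
  rw [tendsto_congr' h]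
  refine ⟨fun h => ?_, fun h => h.const_sub 1⟩
  simpa using h.const_sub 1

theorem eventually_proportion_compl_iUnion_lt (hp : HasProd f p)
    (hfin : ∀ S : Finset ι,
      Tendsto (fun H => proportion (B H) (⋃ i ∈ S, L i)ᶜ) atTop (𝓝 (∏ i ∈ S, f i)))
    {x : ℝ} (hx : p < x) : ∀ᶠ H in atTop, proportion (B H) (⋃ i, L i)ᶜ < x := by
  obtain ⟨S, hS⟩ := (hp.eventually_lt_const hx).exists
  filter_upwards [(hfin S).eventually_lt_const hS] with H hH
  refine (proportion_mono fun a _ ha => ?_).trans_lt hH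
  exact Set.compl_subset_compl.2 (Set.iUnion₂_subset_iUnion _ _) ha

theorem tendsto_proportion_compl_iUnion_of_hasProd_zero (hp : HasProd f 0)
    (hfin : ∀ S : Finset ι,
      Tendsto (fun H => proportion (B H) (⋃ i ∈ S, L i)ᶜ) atTop (𝓝 (∏ i ∈ S, f i))) :
    Tendsto (fun H => proportion (B H) (⋃ i, L i)ᶜ) atTop (𝓝 0) :=
  tendsto_order.2 ⟨fun _ hx => .of_forall fun _ => hx.trans_le proportion_nonneg,
    fun _ hx => eventually_proportion_compl_iUnion_lt hp hfin hx⟩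

theorem tendsto_proportion_compl_iUnion (hp : HasProd f p)
    (hfin : ∀ S : Finset ι,
      Tendsto (fun H => proportion (B H) (⋃ i ∈ S, L i)ᶜ) atTop (𝓝 (∏ i ∈ S, f i)))
    (htail : ∀ ε > 0, ∀ᶠ S : Finset ι in atTop, ∀ᶠ H in atTop,
      proportion (B H) (⋃ i ∉ S, L i) ≤ ε) :
    Tendsto (fun H => proportion (B H) (⋃ i, L i)ᶜ) atTop (𝓝 p) := by
  refine tendsto_order.2 ⟨fun x hx => ?_,
    fun x hx => eventually_proportion_compl_iUnion_lt hp hfin hx⟩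
  obtain ⟨y, hxy, hyp⟩ := exists_between hx
  obtain ⟨S, hS, hyS⟩ :=
    ((htail (y - x) (sub_pos.2 hxy)).and (hp.eventually_const_lt hyp)).exists
  filter_upwards [hS, (hfin S).eventually_const_lt hyS] with H hH hyH
  have hcover : proportion (B H) (⋃ i ∈ S, L i)ᶜ ≤
      proportion (B H) ((⋃ i, L i)ᶜ ∪ ⋃ i ∉ S, L i) := by
    refine proportion_mono fun a _ ha => ?_
    simp only [Set.mem_compl_iff, Set.mem_iUnion, Set.mem_union] at ha ⊢
    grind
  linarith [hcover.trans proportion_union_le]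

end Sieve

section Products

open Filter Topology

variable {ι : Type*} {a : ι → ℝ}

theorem multipliable_one_sub_of_mem_Icc (ha : ∀ i, a i ∈ Set.Icc 0 1) :
    Multipliable fun i => 1 - a i := by
  have h0 : ∀ i, 0 ≤ 1 - a i := fun i => sub_nonneg.2 (ha i).2
  have h1 : ∀ i, 1 - a i ≤ 1 := fun i => sub_le_self 1 (ha i).1
  exact ⟨_, tendsto_atTop_ciInf (Finset.prod_anti_set_of_le_one h0 h1)
    ⟨0, Set.forall_mem_range.2 fun s => Finset.prod_nonneg fun i _ => h0 i⟩⟩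

theorem hasProd_one_sub_zero_of_not_summable (ha : ∀ i, a i ∈ Set.Icc 0 1) (h : ¬ Summable a) :
    HasProd (fun i => 1 - a i) 0 := by
  have hsum : Tendsto (fun s : Finset ι => ∑ i ∈ s, a i) atTop atTop := by
    refine tendsto_atTop_atTop.2 fun b => ?_
    by_contra! hb
    refine h (summable_of_sum_le (c := b) (fun i => (ha i).1) fun s => ?_)
    obtain ⟨t, hst, ht⟩ := hb s
    exact (Finset.sum_le_sum_of_subset_of_nonneg hst fun i _ _ => (ha i).1).trans ht.le
  refine squeeze_zero (fun s => Finset.prod_nonneg fun i _ => sub_nonneg.2 (ha i).2) (fun s => ?_)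
    (Real.tendsto_exp_neg_atTop_nhds_zero.comp hsum)
  calc ∏ i ∈ s, (1 - a i) ≤ ∏ i ∈ s, Real.exp (-a i) :=
        Finset.prod_le_prod (fun i _ => sub_nonneg.2 (ha i).2) fun i _ => Real.one_sub_le_exp_neg _
    _ = Real.exp (-∑ i ∈ s, a i) := by rw [← Real.exp_sum, Finset.sum_neg_distrib]

end Products

section Cube

open Finset Filter Topology

variable {ι M G : Type*} [AddCommGroup M] [AddCommGroup G] (b : Module.Basis ι ℤ M)

theorem exists_factor_through_coord_mod [Finite ι] {q : ℕ} (hq : ∀ g : G, q • g = 0) (f : M →+ G) :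
    ∃ φ : (ι → ZMod q) →+ G, ∀ x, φ (fun j => b.repr x j) = f x := by
  cases nonempty_fintype ι
  refine ⟨∑ j, (ZMod.lift q ⟨zmultiplesHom G (f (b j)), ?_⟩).comp (Pi.evalAddMonoidHom _ j),
    fun x => ?_⟩
  · rw [zmultiplesHom_apply, natCast_zsmul, hq]
  · conv_rhs => rw [← b.sum_repr x, map_sum]
    simp [AddMonoidHom.finsetSum_apply]

variable [Fintype ι]

open Classical in
/-- The elements of `M` whose coordinates in the basis `b` are integers in `[-H, H)`. -/
noncomputable def cube (H : ℕ) : Finset M :=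
  (Fintype.piFinset fun _ => Ico (-(H : ℤ)) H).map b.equivFun.symm.toEquiv.toEmbedding

variable {b}

theorem mem_cube {H : ℕ} {x : M} : x ∈ cube b H ↔ ∀ j, b.repr x j ∈ Set.Ico (-(H : ℤ)) H := by
  classical
  rw [cube, mem_map_equiv, Fintype.mem_piFinset]
  simp [Module.Basis.equivFun_apply]

theorem card_cube (H : ℕ) : #(cube b H) = (2 * H) ^ Fintype.card ι := by
  classical
  rw [cube, card_map, Fintype.card_piFinset, prod_const, card_univ, Int.card_Ico]
  congr 1
  omega

theorem cube_nonempty {H : ℕ} (hH : 0 < H) : (cube b H).Nonempty :=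
  card_pos.1 (by rw [card_cube]; positivity)

theorem card_filter_cast_Ico_mem_Icc {q : ℕ} [NeZero q] (H : ℕ) (v : ZMod q) :
    #{t ∈ Ico (-(H : ℤ)) H | ((t : ℤ) : ZMod q) = v} ∈ Set.Icc (2 * H / q) (2 * H / q + 1) := by
  have hcount : #{t ∈ Ico (-(H : ℤ)) H | ((t : ℤ) : ZMod q) = v} =
      (2 * H).count (· ≡ (v + H).val [MOD q]) := by
    rw [Nat.count_eq_card_filter_range, Int.Ico_eq_finset_map, filter_map, card_map]
    congr 1
    ext n
    have hn : (n : ℤ) < H + H ↔ n < H + H := by norm_cast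
    simp [← ZMod.natCast_eq_natCast_iff, ← sub_eq_add_neg, sub_eq_iff_eq_add, two_mul,
      add_comm (-(H : ZMod q)), hn]
  rw [hcount, Nat.count_modEq_card _ (NeZero.pos q)]
  split_ifs <;> simp

theorem card_cube_filter_coord_mem_Icc {q : ℕ} [NeZero q] (H : ℕ) (v : ι → ZMod q) :
    #{x ∈ cube b H | (fun j => ((b.repr x j : ℤ) : ZMod q)) = v} ∈
      Set.Icc ((2 * H / q) ^ Fintype.card ι) ((2 * H / q + 1) ^ Fintype.card ι) := by
  classical
  have hprod : #{x ∈ cube b H | (fun j => ((b.repr x j : ℤ) : ZMod q)) = v} =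
      ∏ j, #{t ∈ Ico (-(H : ℤ)) H | ((t : ℤ) : ZMod q) = v j} := by
    rw [← Fintype.card_piFinset, cube, filter_map, card_map]
    congr 1
    ext y
    simp [funext_iff, forall_and, Module.Basis.equivFun]
  have hcoord := fun j => card_filter_cast_Ico_mem_Icc H (v j)
  rw [hprod, ← card_univ, ← prod_const, ← prod_const]
  exact ⟨prod_le_prod' fun j _ => (hcoord j).1, prod_le_prod' fun j _ => (hcoord j).2⟩

theorem ncard_preimage_of_surjective {A : Type*} [AddGroup A] [Finite A] {φ : A →+ G}
    (hφ : Function.Surjective φ) (T : Set G) :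
    Nat.card G * (φ ⁻¹' T).ncard = T.ncard * Nat.card A := by
  classical
  have : Finite G := .of_surjective φ hφ
  have := Fintype.ofFinite A
  have := Fintype.ofFinite G
  have hfiber : ∀ g, #{v | φ v = g} = #{v | φ v = 0} := fun g =>
    AddMonoidHom.card_fiber_eq_of_mem_range φ (hφ g) (hφ 0)
  have hA : Nat.card A = Nat.card G * #{v | φ v = 0} := by
    rw [Nat.card_eq_fintype_card, ← card_univ, card_eq_sum_card_fiberwise fun a _ => mem_univ (φ a),
      sum_const_nat fun g _ => hfiber g, card_univ, Nat.card_eq_fintype_card]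
  have hT : (φ ⁻¹' T).ncard = T.ncard * #{v | φ v = 0} := by
    rw [Set.ncard_eq_toFinset_card', Set.ncard_eq_toFinset_card' T,
      card_eq_sum_card_fiberwise (f := φ) (t := T.toFinset) fun v hv => by simpa using hv]
    refine sum_const_nat fun g hg => ?_
    rw [← hfiber g]
    congr 1
    grind
  rw [hA, hT]
  ring

theorem ncard_preimage_inter_cube_mem_Icc {q : ℕ} [NeZero q] (hq : ∀ g : G, q • g = 0)
    {f : M →+ G} (hf : Function.Surjective f) (T : Set G) (H : ℕ) :
    Nat.card G * (f ⁻¹' T ∩ cube b H).ncard ∈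
      Set.Icc (T.ncard * (2 * H / q * q) ^ Fintype.card ι)
        (T.ncard * ((2 * H / q + 1) * q) ^ Fintype.card ι) := by
  classical
  obtain ⟨φ, hφ⟩ := exists_factor_through_coord_mod b hq f
  have hsurj : Function.Surjective φ := fun g => (hf g).elim fun x hx => ⟨_, (hφ x).trans hx⟩
  set V : Finset (ι → ZMod q) := {v | φ v ∈ T}
  have hV : Nat.card G * #V = T.ncard * q ^ Fintype.card ι := by
    rw [← Set.ncard_coe_finset]
    simpa [V, Set.preimage] using ncard_preimage_of_surjective hsurj T
  set B : Finset M := {x ∈ cube b H | f x ∈ T}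
  have hB : (f ⁻¹' T ∩ cube b H).ncard = #B := by
    rw [← Set.ncard_coe_finset]
    congr 1
    ext x
    simp [B, and_comm]
  have hmaps : ∀ x ∈ B, (fun j => ((b.repr x j : ℤ) : ZMod q)) ∈ V := fun x hx => by
    simpa [V, hφ] using (mem_filter.1 hx).2
  have hfiber : ∀ v ∈ V, #{x ∈ B | (fun j => ((b.repr x j : ℤ) : ZMod q)) = v} ∈
      Set.Icc ((2 * H / q) ^ Fintype.card ι) ((2 * H / q + 1) ^ Fintype.card ι) := by
    intro v hv
    have hB : {x ∈ B | (fun j => ((b.repr x j : ℤ) : ZMod q)) = v} =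
        {x ∈ cube b H | (fun j => ((b.repr x j : ℤ) : ZMod q)) = v} := by
      ext x
      have := hφ x
      simp only [V, B, mem_filter, mem_univ, true_and] at hv ⊢
      grind
    rw [hB]
    exact card_cube_filter_coord_mem_Icc H v
  rw [hB, mul_pow, mul_pow, mul_left_comm, mul_left_comm T.ncard, ← hV, mul_left_comm,
    mul_left_comm _ (Nat.card G)]
  exact ⟨Nat.mul_le_mul_left _ (mul_card_image_le_card_of_maps_to hmaps _ fun v hv =>
      (hfiber v hv).1),
    Nat.mul_le_mul_left _ (card_le_mul_card_image_of_maps_to hmaps _ fun v hv => (hfiber v hv).2)⟩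

theorem tendsto_div_mul_div_self {q : ℕ} (hq : q ≠ 0) :
    Tendsto (fun n : ℕ => ((n / q * q : ℕ) : ℝ) / n) atTop (𝓝 1) := by
  have h := ((tendsto_nat_floor_mul_div_atTop (by positivity : (0 : ℝ) ≤ (q : ℝ)⁻¹)).comp
    tendsto_natCast_atTop_atTop).mul_const (q : ℝ)
  rw [inv_mul_cancel₀ (by exact_mod_cast hq)] at h
  refine h.congr fun n => ?_
  rw [Function.comp_apply, inv_mul_eq_div, Nat.floor_div_eq_div, Nat.cast_mul, div_mul_eq_mul_div]

theorem tendsto_div_add_one_mul_div_self {q : ℕ} (hq : q ≠ 0) :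
    Tendsto (fun n : ℕ => (((n / q + 1) * q : ℕ) : ℝ) / n) atTop (𝓝 1) := by
  have h := (tendsto_div_mul_div_self hq).add (tendsto_const_div_atTop_nhds_zero_nat (q : ℝ))
  rw [add_zero] at h
  refine h.congr fun n => ?_
  push_cast
  ring

theorem proportion_cube (H : ℕ) (T : Set M) :
    proportion (cube b H) T = (T ∩ cube b H).ncard / ((2 * H : ℕ) : ℝ) ^ Fintype.card ι := by
  rw [proportion, card_cube, Nat.cast_pow]

theorem tendsto_proportion_cube_preimage [Finite G] {f : M →+ G} (hf : Function.Surjective f)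
    (T : Set G) :
    Tendsto (fun H => proportion (cube b H) (f ⁻¹' T)) atTop (𝓝 (T.ncard / Nat.card G)) := by
  have hG : (0 : ℝ) < Nat.card G := by exact_mod_cast Nat.card_pos
  have hG' : Nat.card G ≠ 0 := Nat.card_pos.ne'
  have : NeZero (Nat.card G) := ⟨hG'⟩
  have hbound := fun H => ncard_preimage_inter_cube_mem_Icc (b := b) (q := Nat.card G)
    (fun g => card_nsmul_eq_zero') hf T H
  have htwo : Tendsto (fun H : ℕ => 2 * H) atTop atTop := tendsto_id.const_mul_atTop' two_pos
  have hlow := (((tendsto_div_mul_div_self hG').comp htwo).pow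
    (Fintype.card ι)).const_mul (T.ncard / Nat.card G : ℝ)
  have hupp := (((tendsto_div_add_one_mul_div_self hG').comp htwo).pow
    (Fintype.card ι)).const_mul (T.ncard / Nat.card G : ℝ)
  rw [one_pow, mul_one] at hlow hupp
  refine tendsto_of_tendsto_of_tendsto_of_le_of_le hlow hupp (fun H => ?_) fun H => ?_
  · rw [proportion_cube, Function.comp_apply, div_pow, div_mul_div_comm, ← div_div]
    gcongr
    rw [div_le_iff₀' hG]
    exact_mod_cast (hbound H).1
  · rw [proportion_cube, Function.comp_apply, div_pow, div_mul_div_comm, ← div_div]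
    gcongr
    rw [le_div_iff₀' hG]
    exact_mod_cast (hbound H).2

theorem proportion_cube_preimage_le [Finite G] {q : ℕ} [NeZero q] (hq : ∀ g : G, q • g = 0)
    {f : M →+ G} (hf : Function.Surjective f) (T : Set G) {H : ℕ} (hH : q ≤ 2 * H) :
    proportion (cube b H) (f ⁻¹' T) ≤ 2 ^ Fintype.card ι * (T.ncard / Nat.card G) := by
  have hG : (0 : ℝ) < Nat.card G := by exact_mod_cast Nat.card_pos
  have hle : (2 * H / q + 1) * q ≤ 2 * (2 * H) := by
    have := Nat.div_mul_le_self (2 * H) q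
    linarith
  have hcount : Nat.card G * (f ⁻¹' T ∩ cube b H).ncard ≤
      T.ncard * (2 * (2 * H)) ^ Fintype.card ι :=
    (ncard_preimage_inter_cube_mem_Icc hq hf T H).2.trans (by gcongr)
  rw [proportion_cube, ← mul_div_assoc, le_div_iff₀' hG, mul_div_assoc']
  refine div_le_of_le_mul₀ (by positivity) (by positivity) ?_
  rw [mul_right_comm, ← mul_pow, mul_comm _ (T.ncard : ℝ)]
  exact_mod_cast hcount

theorem proportion_cube_le_inv_of_coord_determined {H : ℕ} {T : Set M} (j : ι)
    (hT : ∀ x ∈ cube b H, ∀ y ∈ cube b H, x ∈ T → y ∈ T →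
      (∀ i ≠ j, b.repr x i = b.repr y i) → x = y) :
    proportion (cube b H) T ≤ (2 * H : ℝ)⁻¹ := by
  classical
  let B : Finset M := {x ∈ cube b H | x ∈ T}
  let move (p : ℤ × M) : M := p.2 + (p.1 - b.repr p.2 j) • b j
  have hmove_self (p : ℤ × M) : b.repr (move p) j = p.1 := by simp [move]
  have hmove_ne (p : ℤ × M) {i : ι} (hi : i ≠ j) : b.repr (move p) i = b.repr p.2 i := by
    simp [move, Finsupp.single_eq_of_ne hi]
  have hmaps : Set.MapsTo move ((Ico (-(H : ℤ)) H ×ˢ B : Finset (ℤ × M)) : Set _) (cube b H) := by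
    intro p hp
    obtain ⟨ht, hx⟩ := mem_product.1 hp
    refine mem_cube.2 fun i => ?_
    by_cases hi : i = j
    · rw [hi, hmove_self]
      exact mem_Ico.1 ht
    · rw [hmove_ne p hi]
      exact mem_cube.1 (mem_filter.1 hx).1 i
  have hinj : Set.InjOn move ((Ico (-(H : ℤ)) H ×ˢ B : Finset (ℤ × M)) : Set _) := by
    intro p hp p' hp' heq
    have hx := mem_filter.1 (mem_product.1 hp).2
    have hx' := mem_filter.1 (mem_product.1 hp').2
    refine Prod.ext ?_ (hT _ hx.1 _ hx'.1 hx.2 hx'.2 fun i hi => ?_)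
    · rw [← hmove_self, heq, hmove_self]
    · rw [← hmove_ne p hi, heq, hmove_ne p' hi]
  have hcard : 2 * H * #B ≤ #(cube b H) := by
    have := card_le_card_of_injOn move hmaps hinj
    rwa [card_product, Int.card_Ico, sub_neg_eq_add, ← two_mul,
      show (2 * (H : ℤ)).toNat = 2 * H by omega] at this
  have hB : (T ∩ cube b H).ncard = #B := by
    rw [← Set.ncard_coe_finset, coe_filter, Set.inter_comm]
    rfl
  rcases H.eq_zero_or_pos with rfl | hH
  · have : Nonempty ι := ⟨j⟩
    have : #(cube b 0) = 0 := by simp [card_cube]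
    simp [proportion, this]
  · refine div_le_of_le_mul₀ (by positivity) (by positivity) ?_
    rw [hB, le_inv_mul_iff₀ (by positivity)]
    exact_mod_cast hcard

theorem proportion_fiber_le_inv {f : M →+ G} {H : ℕ} (j : ι)
    (hj : ∀ n : ℤ, |n| < 2 * H → n • f (b j) = 0 → n = 0) (g : G) :
    proportion (cube b H) (f ⁻¹' {g}) ≤ (2 * H : ℝ)⁻¹ := by
  refine proportion_cube_le_inv_of_coord_determined j fun x hx y hy hxg hyg hxy => ?_
  have hsub : x - y = (b.repr x j - b.repr y j) • b j := by
    refine b.repr.injective (Finsupp.ext fun i => ?_)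
    rcases eq_or_ne i j with rfl | hi
    · simp
    · simp [Finsupp.single_eq_of_ne hi, hxy i hi]
  have hbound : |b.repr x j - b.repr y j| < 2 * H := by
    have := mem_cube.1 hx j
    have := mem_cube.1 hy j
    grind
  have hzero : (b.repr x j - b.repr y j) • f (b j) = 0 := by
    rw [← map_zsmul, ← hsub, map_sub, hxg, hyg, sub_self]
  rwa [hj _ hbound hzero, zero_smul, sub_eq_zero] at hsub

end Cube

section TupleCube

open Finset

variable {ι M : Type*} [Fintype ι] [AddCommGroup M] (b : Module.Basis ι ℤ M)

/-- The `n`-tuples of elements of `cube b H`, which form a cube of the lattice `Fin n → M`. -/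
noncomputable abbrev tupleCube (n H : ℕ) : Finset (Fin n → M) :=
  cube (Pi.basis fun _ : Fin n => b) H

variable {b}

theorem mem_tupleCube {n H : ℕ} {a : Fin n → M} : a ∈ tupleCube b n H ↔ ∀ i, a i ∈ cube b H := by
  simp only [mem_cube, Sigma.forall, Pi.basis_repr]

theorem card_tupleCube (n H : ℕ) : #(tupleCube b n H) = (2 * H) ^ (n * Fintype.card ι) := by
  simp [card_cube]

theorem proportion_tupleCube_succ_le {n H : ℕ} {T : Set (Fin (n + 1) → M)} {c : ℝ} (hc : 0 ≤ c)
    (h : ∀ t ∈ tupleCube b n H, proportion (cube b H) {x | Fin.cons x t ∈ T} ≤ c) :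
    proportion (tupleCube b (n + 1) H) T ≤ c := by
  classical
  let B : Finset (Fin (n + 1) → M) := {a ∈ tupleCube b (n + 1) H | a ∈ T}
  have hB : (T ∩ tupleCube b (n + 1) H).ncard = #B := by
    rw [← Set.ncard_coe_finset, coe_filter, Set.inter_comm]
    rfl
  have htail : ∀ a ∈ B, Fin.tail a ∈ tupleCube b n H := fun a ha =>
    mem_tupleCube.2 fun i => mem_tupleCube.1 (mem_filter.1 ha).1 i.succ
  have hfiber : ∀ t ∈ tupleCube b n H, (#{a ∈ B | Fin.tail a = t} : ℝ) ≤ c * #(cube b H) := by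
    intro t ht
    refine le_trans ?_ (ncard_inter_le_of_proportion_le (h t ht))
    rw [← Set.ncard_coe_finset]
    refine Nat.cast_le.2 (Set.ncard_le_ncard_of_injOn (fun a => a 0) ?_ ?_
      ((cube b H).finite_toSet.inter_of_right _))
    · intro a ha
      obtain ⟨haB, rfl⟩ := mem_filter.1 ha
      obtain ⟨hmem, haT⟩ := mem_filter.1 haB
      refine ⟨?_, mem_tupleCube.1 hmem 0⟩
      rwa [Set.mem_ofPred_eq, Fin.cons_self_tail]
    · intro a ha a' ha' h0
      change a 0 = a' 0 at h0
      rw [← Fin.cons_self_tail a, ← Fin.cons_self_tail a', (mem_filter.1 ha).2,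
        (mem_filter.1 ha').2, h0]
  refine div_le_of_le_mul₀ (by positivity) hc ?_
  calc ((T ∩ tupleCube b (n + 1) H).ncard : ℝ)
      = ∑ t ∈ tupleCube b n H, (#{a ∈ B | Fin.tail a = t} : ℝ) := by
        rw [hB, card_eq_sum_card_fiberwise htail, Nat.cast_sum]
    _ ≤ #(tupleCube b n H) • (c * #(cube b H)) := sum_le_card_nsmul _ _ _ hfiber
    _ = c * #(tupleCube b (n + 1) H) := by
        rw [nsmul_eq_mul, card_tupleCube, card_tupleCube, card_cube]
        push_cast
        ring

theorem hasDensityWrt_iff {K : Type*} [Field K] [NumberField K]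
    {E : Module.Basis (Fin (Module.finrank ℚ K)) ℤ (𝓞 K)} {n : ℕ} {T : Set (Fin n → 𝓞 K)} {ρ : ℝ} :
    HasDensityWrt E T ρ ↔
      Filter.Tendsto (fun H => proportion (tupleCube E n H) T) Filter.atTop (nhds ρ) := by
  rw [HasDensityWrt]
  refine Filter.tendsto_congr fun H => ?_
  rw [proportion, card_tupleCube, Fintype.card_fin]
  congr 3
  · ext a
    simp only [Set.mem_inter_iff, Set.mem_ofPred_eq, Finset.mem_coe, mem_cube, Sigma.forall,
      Pi.basis_repr, box]
  · push_cast
    rfl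

end TupleCube

section LocalSet

variable {R S : Type*} [CommRing R] [CommRing S] {d : ℕ}

theorem coeff_toPoly (a : Fin (d + 1) → R) (i : Fin (d + 1)) : (toPoly a).coeff i = a i := by
  simp [toPoly, coeff_X_pow, Fin.val_inj]

theorem coeff_toPoly_of_lt (a : Fin (d + 1) → R) {n : ℕ} (hn : d < n) :
    (toPoly a).coeff n = 0 := by
  simp only [toPoly, finsetSum_coeff, coeff_C_mul, coeff_X_pow]
  exact Finset.sum_eq_zero fun i _ => by rw [if_neg (by omega), mul_zero]

theorem natDegree_toPoly_le (a : Fin (d + 1) → R) : (toPoly a).natDegree ≤ d :=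
  natDegree_le_iff_coeff_eq_zero.2 fun _ hn => coeff_toPoly_of_lt a hn

theorem toPoly_coeff {f : R[X]} (hf : f.natDegree ≤ d) :
    toPoly (fun i : Fin (d + 1) => f.coeff i) = f := by
  ext n
  rcases le_or_gt n d with h | h
  · exact coeff_toPoly (fun i : Fin (d + 1) => f.coeff i) ⟨n, by omega⟩
  · rw [coeff_toPoly_of_lt _ h, coeff_eq_zero_of_natDegree_lt (by omega)]

theorem map_toPoly (φ : R →+* S) (a : Fin (d + 1) → R) :
    (toPoly a).map φ = toPoly (φ ∘ a) := by
  simp [toPoly, Polynomial.map_sum]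

theorem eval_toPoly (a : Fin (d + 1) → R) (c : R) :
    (toPoly a).eval c = ∑ i, a i * c ^ (i : ℕ) := by
  simp [toPoly, eval_finsetSum]

/-- The coefficient tuple of `f (X + b)`, where `f` has coefficient tuple `a`. -/
noncomputable def translate (b : R) (a : Fin (d + 1) → R) : Fin (d + 1) → R :=
  fun i => (taylor b (toPoly a)).coeff i

theorem toPoly_translate (b : R) (a : Fin (d + 1) → R) :
    toPoly (translate b a) = taylor b (toPoly a) :=
  toPoly_coeff (by rw [natDegree_taylor]; exact natDegree_toPoly_le a)

theorem translate_translate (b c : R) (a : Fin (d + 1) → R) :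
    translate b (translate c a) = translate (b + c) a := by
  funext i
  rw [translate, toPoly_translate, taylor_taylor, translate]

theorem translate_zero (a : Fin (d + 1) → R) : translate 0 a = a := by
  funext i
  simp [translate, coeff_toPoly]

theorem map_translate (φ : R →+* S) (b : R) (a : Fin (d + 1) → R) :
    φ ∘ translate b a = translate (φ b) (φ ∘ a) := by
  funext i
  simp only [translate, Function.comp_apply]
  rw [← map_toPoly, ← map_taylor, coeff_map]

theorem translate_last (b : R) (a : Fin (d + 1) → R) :
    translate b a (Fin.last d) = a (Fin.last d) := by
  have h : hasseDeriv d (toPoly a) = C ((toPoly a).coeff d) := by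
    ext n
    rw [hasseDeriv_coeff, coeff_C]
    split_ifs with h
    · simp [h]
    · rw [coeff_toPoly_of_lt a (by omega), mul_zero]
  rw [translate, taylor_coeff, Fin.val_last, h, eval_C]
  exact coeff_toPoly a (Fin.last d)

theorem translate_apply_zero (b : R) (a : Fin (d + 1) → R) :
    translate b a 0 = ∑ i, a i * b ^ (i : ℕ) := by
  simp [translate, eval_toPoly]

/-- The polynomial `a 0 + ⋯ + a d X ^ d`, regarded as one of degree `d`, is `P`-Eisenstein. Unlike
`Polynomial.IsEisensteinAt`, this excludes the polynomials of smaller degree. -/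
def IsEisensteinTuple (P : Ideal R) (a : Fin (d + 1) → R) : Prop :=
  a (Fin.last d) ∉ P ∧ (∀ i : Fin d, a i.castSucc ∈ P) ∧ a 0 ∉ P ^ 2

/-- The coefficient tuples of the shifted `P`-Eisenstein polynomials of degree `d`. -/
def localSet (d : ℕ) (P : Ideal R) : Set (Fin (d + 1) → R) :=
  {a | ∃ b, IsEisensteinTuple P (translate b a)}

theorem last_ne_zero_of_mem_localSet {d : ℕ} {P : Ideal R} {a : Fin (d + 1) → R}
    (ha : a ∈ localSet d P) : a (Fin.last d) ≠ 0 := by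
  obtain ⟨c, hc⟩ := ha
  intro h
  exact hc.1 (by rw [translate_last, h]; exact P.zero_mem)

theorem isEisensteinAt_toPoly_iff {P : Ideal R} {a : Fin (d + 1) → R}
    (h : (toPoly a).natDegree = d) : (toPoly a).IsEisensteinAt P ↔ IsEisensteinTuple P a := by
  have hzero : (toPoly a).coeff 0 = a 0 := coeff_toPoly a 0
  have hlead : (toPoly a).leadingCoeff = a (Fin.last d) := by
    rw [leadingCoeff, h]
    exact coeff_toPoly a (Fin.last d)
  constructor
  · intro ha
    refine ⟨hlead ▸ ha.leading, fun i => ?_, hzero ▸ ha.notMem⟩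
    rw [← coeff_toPoly a i.castSucc]
    exact ha.mem (by simp [h])
  · rintro ⟨hlast, hmem, hnotMem⟩
    refine ⟨hlead ▸ hlast, fun {n} hn => ?_, hzero ▸ hnotMem⟩
    rw [h] at hn
    simpa [← coeff_toPoly a] using hmem ⟨n, hn⟩

theorem mem_localSet_iff {P : Ideal R} {a : Fin (d + 1) → R} :
    a ∈ localSet d P ↔ (toPoly a).natDegree = d ∧ IsShiftedEisensteinAt (toPoly a) P := by
  have hiff (b : R) (h : (toPoly a).natDegree = d) :
      ((toPoly a).comp (X + C b)).IsEisensteinAt P ↔ IsEisensteinTuple P (translate b a) := by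
    rw [← isEisensteinAt_toPoly_iff, toPoly_translate, taylor_apply]
    rw [toPoly_translate, natDegree_taylor, h]
  constructor
  · rintro ⟨b, hb⟩
    have h : (toPoly a).natDegree = d := by
      refine le_antisymm (natDegree_toPoly_le a) (le_natDegree_of_ne_zero fun h0 => hb.1 ?_)
      rw [translate_last, ← coeff_toPoly a (Fin.last d), Fin.val_last, h0]
      exact P.zero_mem
    exact ⟨h, b, (hiff b h).2 hb⟩
  · rintro ⟨h, b, hb⟩
    exact ⟨b, (hiff b h).1 hb⟩

theorem mem_map_of_ker_le {φ : R →+* S} (hφ : Function.Surjective φ) {I : Ideal R}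
    (hI : RingHom.ker φ ≤ I) {x : R} : φ x ∈ I.map φ ↔ x ∈ I := by
  rw [← Ideal.mem_comap, Ideal.comap_map_of_surjective' φ hφ, sup_eq_left.2 hI]

theorem comp_mem_localSet_iff {φ : R →+* S} (hφ : Function.Surjective φ) {P : Ideal R}
    (hP : RingHom.ker φ ≤ P ^ 2) {a : Fin (d + 1) → R} :
    φ ∘ a ∈ localSet d (P.map φ) ↔ a ∈ localSet d P := by
  have hP1 : RingHom.ker φ ≤ P := hP.trans (Ideal.pow_le_self two_ne_zero)
  refine hφ.exists.trans (exists_congr fun b => ?_)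
  rw [← map_translate]
  simp only [IsEisensteinTuple, Function.comp_apply, ← Ideal.map_pow, mem_map_of_ker_le hφ hP,
    mem_map_of_ker_le hφ hP1]

theorem IsEisensteinTuple.mem_of_translate {P : Ideal R} [hP : P.IsPrime] (hd : 1 ≤ d)
    {a : Fin (d + 1) → R} {c : R} (ha : IsEisensteinTuple P a)
    (hc : IsEisensteinTuple P (translate c a)) : c ∈ P := by
  have hzero : translate c a 0 ∈ P := by simpa using hc.2.1 ⟨0, hd⟩
  rw [translate_apply_zero, Fin.sum_univ_castSucc] at hzero
  have hlast : a (Fin.last d) * c ^ d ∈ P :=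
    (P.add_mem_iff_right (P.sum_mem fun i _ => P.mul_mem_right _ (ha.2.1 i))).1 hzero
  exact hP.mem_of_pow_mem _ ((hP.mem_or_mem hlast).resolve_left ha.1)

theorem IsEisensteinTuple.translate {P : Ideal R} (hd : 2 ≤ d)
    {a : Fin (d + 1) → R} {c : R} (ha : IsEisensteinTuple P a) (hc : c ∈ P) :
    IsEisensteinTuple P (translate c a) := by
  refine ⟨by rw [translate_last]; exact ha.1, fun i => ?_, ?_⟩
  · have h := congrFun (map_translate (Ideal.Quotient.mk P) c a) i.castSucc
    rw [Ideal.Quotient.eq_zero_iff_mem.2 hc, translate_zero] at h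
    rw [← Ideal.Quotient.eq_zero_iff_mem]
    exact h.trans (Ideal.Quotient.eq_zero_iff_mem.2 (ha.2.1 i))
  · rw [translate_apply_zero, Fin.sum_univ_succ, Ideal.add_mem_iff_left]
    · simpa using ha.2.2
    · refine Ideal.sum_mem _ fun i _ => ?_
      rw [Fin.val_succ]
      rcases Nat.lt_or_ge (i + 1 : ℕ) d with hi | hi
      · rw [pow_succ' c, sq, ← mul_assoc]
        exact Ideal.mul_mem_right _ _ (Ideal.mul_mem_mul (ha.2.1 ⟨i + 1, hi⟩) hc)
      · exact Ideal.mul_mem_left _ _ (Ideal.pow_le_pow_right (by omega) (Ideal.pow_mem_pow hc _))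

theorem ncard_univ_pi {ι : Type*} [Fintype ι] {α : ι → Type*} (t : ∀ i, Set (α i)) :
    (Set.univ.pi t).ncard = ∏ i, (t i).ncard := by
  simp_rw [← Nat.card_coe_set_eq, ← Nat.card_pi]
  exact Nat.card_congr (Equiv.Set.univPi t)

theorem ncard_isEisensteinTuple (P : Ideal R) (e : ℕ) :
    {a : Fin (e + 1 + 1) → R | IsEisensteinTuple P a}.ncard =
      (P \ ↑(P ^ 2) : Set R).ncard * (P : Set R).ncard ^ e * (P : Set R)ᶜ.ncard := by
  let t : Fin (e + 1 + 1) → Set R :=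
    Fin.snoc (Fin.cons (P \ ↑(P ^ 2)) fun _ => P : Fin (e + 1) → Set R) Pᶜ
  have hzero : t 0 = (P \ ↑(P ^ 2) : Set R) := rfl
  have hsucc (i : Fin e) : t i.castSucc.succ = P := by
    simp only [t, Fin.succ_castSucc, Fin.snoc_castSucc, Fin.cons_succ]
  have hlast : t (Fin.last (e + 1)) = (P : Set R)ᶜ := Fin.snoc_last _ _
  have h : {a : Fin (e + 1 + 1) → R | IsEisensteinTuple P a} = Set.univ.pi t := by
    ext a
    simp only [IsEisensteinTuple, Set.mem_ofPred_eq, Set.mem_univ_pi,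
      Fin.forall_fin_succ' (n := e + 1), Fin.forall_fin_succ (n := e), Fin.castSucc_zero,
      Fin.castSucc_succ, hzero, hsucc, hlast, Set.mem_sdiff, SetLike.mem_coe, Set.mem_compl_iff]
    tauto
  rw [h, ncard_univ_pi, Fin.prod_univ_castSucc, Fin.prod_univ_succ]
  simp only [Fin.castSucc_zero, Fin.castSucc_succ, hzero, hsucc, hlast, Finset.prod_const,
    Finset.card_univ, Fintype.card_fin]

theorem ncard_localSet (P : Ideal R) [P.IsPrime] (hd : 2 ≤ d) :
    (localSet d P).ncard =
      Nat.card (R ⧸ P) * {a : Fin (d + 1) → R | IsEisensteinTuple P a}.ncard := by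
  have hd1 : 1 ≤ d := one_le_two.trans hd
  have hcancel (b : R) (a : Fin (d + 1) → R) : translate b (translate (-b) a) = a := by
    rw [translate_translate, add_neg_cancel, translate_zero]
  let shift (p : (R ⧸ P) × {a : Fin (d + 1) → R | IsEisensteinTuple P a}) : localSet d P :=
    ⟨translate p.1.out p.2, -p.1.out, by
      rw [translate_translate, neg_add_cancel, translate_zero]; exact p.2.2⟩
  have hinj : Function.Injective shift := by
    rintro ⟨y, a, ha⟩ ⟨z, a', ha'⟩ h
    have hshift : translate y.out a = translate z.out a' := congrArg Subtype.val h
    have htranslate : translate (-z.out + y.out) a = a' := by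
      rw [← translate_translate, hshift, translate_translate, neg_add_cancel, translate_zero]
    have hmem : -z.out + y.out ∈ P := ha.mem_of_translate hd1 (htranslate ▸ ha')
    obtain rfl : y = z := by
      rw [neg_add_eq_sub, ← Ideal.Quotient.eq] at hmem
      simpa using hmem
    simpa [translate_zero] using htranslate
  have hsurj : Function.Surjective shift := by
    rintro ⟨a, b, hb⟩
    let y := Ideal.Quotient.mk P (-b)
    have hy : -y.out - b ∈ P := by
      rw [← Ideal.Quotient.eq, map_neg, Ideal.Quotient.mk_out, ← map_neg, neg_neg]
    have ha := hb.translate hd hy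
    rw [translate_translate, sub_add_cancel] at ha
    exact ⟨⟨y, _, ha⟩, Subtype.ext (hcancel _ _)⟩
  rw [← Nat.card_coe_set_eq, ← Nat.card_coe_set_eq, ← Nat.card_prod]
  exact (Nat.card_congr (Equiv.ofBijective shift ⟨hinj, hsurj⟩)).symm

theorem exists_quotient_mk_eq_of_mem_localSet {P : Ideal R} {a : Fin (d + 1) → R}
    (ha : a ∈ localSet d P) :
    ∃ u c : R ⧸ P, u ≠ 0 ∧
      ∀ i : Fin (d + 1), Ideal.Quotient.mk P (a i) = u * (d.choose i * c ^ (d - i : ℕ)) := by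
  obtain ⟨b, hb⟩ := ha
  set π := Ideal.Quotient.mk P
  set u := π (translate b a (Fin.last d))
  refine ⟨u, π (-b), fun hu => hb.1 (Ideal.Quotient.eq_zero_iff_mem.1 hu), fun i => ?_⟩
  have hmonomial : toPoly (π ∘ translate b a) = C u * X ^ d := by
    rw [toPoly, Fin.sum_univ_castSucc, Finset.sum_eq_zero, zero_add]
    · rfl
    · intro i _
      rw [Function.comp_apply, Ideal.Quotient.eq_zero_iff_mem.2 (hb.2.1 i), C_0, zero_mul]
  have h := congrFun (map_translate π (-b) (translate b a)) i
  rw [translate_translate, neg_add_cancel, translate_zero] at h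
  refine h.trans ?_
  rw [EisensteinDensity.translate, hmonomial, taylor_mul, taylor_C, taylor_X_pow, coeff_C_mul,
    coeff_X_add_C_pow, mul_comm (_ ^ _)]

end LocalSet

section LocalDensity

open Filter Topology IsDedekindDomain

variable {R : Type*} [CommRing R] [IsDedekindDomain R] [Module.Free ℤ R]

/-- The density `(N - 1) ^ 2 / N ^ (d + 1)`, with `N = |R ⧸ P|`, of the coefficient tuples of the
shifted `P`-Eisenstein polynomials of degree `d`. -/
noncomputable def localDensity (d : ℕ) (P : Ideal R) : ℝ :=
  ((Ideal.absNorm P : ℝ) - 1) ^ 2 / (Ideal.absNorm P : ℝ) ^ (d + 1)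

theorem natCard_quotient (I : Ideal R) : Nat.card (R ⧸ I) = Ideal.absNorm I := by
  rw [Ideal.absNorm_apply, Submodule.cardQuot_apply]

theorem one_lt_absNorm [Module.Finite ℤ R] (P : HeightOneSpectrum R) :
    1 < Ideal.absNorm P.asIdeal :=
  Nat.one_lt_iff_ne_zero_and_ne_one.2
    ⟨Ideal.absNorm_eq_zero_iff.not.2 P.ne_bot, Ideal.absNorm_eq_one_iff.not.2 P.isPrime.ne_top⟩

theorem localDensity_mem_Icc [Module.Finite ℤ R] {d : ℕ} (hd : 1 ≤ d)
    (P : HeightOneSpectrum R) :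
    localDensity d P.asIdeal ∈ Set.Icc 0 1 := by
  have hN : (1 : ℝ) ≤ Ideal.absNorm P.asIdeal := by exact_mod_cast (one_lt_absNorm P).le
  refine ⟨by unfold localDensity; positivity, div_le_one_of_le₀ ?_ (by positivity)⟩
  calc ((Ideal.absNorm P.asIdeal : ℝ) - 1) ^ 2 ≤ (Ideal.absNorm P.asIdeal : ℝ) ^ 2 := by
        gcongr; linarith
    _ ≤ (Ideal.absNorm P.asIdeal : ℝ) ^ (d + 1) := pow_le_pow_right₀ hN (by omega)

theorem ncard_localSet_map_mk [Module.Finite ℤ R] {d : ℕ} (hd : 2 ≤ d)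
    (P : HeightOneSpectrum R) :
    (localSet d (P.asIdeal.map (Ideal.Quotient.mk (P.asIdeal ^ 2)))).ncard =
      Ideal.absNorm P.asIdeal ^ (d + 1) * (Ideal.absNorm P.asIdeal - 1) ^ 2 := by
  obtain ⟨e, rfl⟩ : ∃ e, d = e + 1 := ⟨d - 1, by omega⟩
  set S := R ⧸ P.asIdeal ^ 2
  set N := Ideal.absNorm P.asIdeal
  set m := P.asIdeal.map (Ideal.Quotient.mk (P.asIdeal ^ 2)) with hm
  have hN : 0 < N := zero_lt_one.trans (one_lt_absNorm P)
  have hcardS : Nat.card S = N ^ 2 := by rw [natCard_quotient, map_pow]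
  have : Finite S := Nat.finite_of_card_ne_zero (by rw [hcardS]; positivity)
  have hle : P.asIdeal ^ 2 ≤ P.asIdeal := Ideal.pow_le_self two_ne_zero
  have : m.IsPrime := by
    have := P.isPrime
    exact Ideal.map_isPrime_of_surjective Ideal.Quotient.mk_surjective
      (by rwa [Ideal.mk_ker])
  have hcardQuot : Nat.card (S ⧸ m) = N :=
    (Nat.card_congr (DoubleQuot.quotQuotEquivQuotOfLE hle).toEquiv).trans (natCard_quotient _)
  have hcardIdeal : (m : Set S).ncard = N := by
    have h := Submodule.card_eq_card_quotient_mul_card m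
    rw [hcardS, hcardQuot, sq] at h
    exact (Nat.eq_of_mul_eq_mul_right hN h).symm
  have hsq : m ^ 2 = ⊥ := by rw [hm, ← Ideal.map_pow, Ideal.map_quotient_self]
  rw [ncard_localSet m hd, ncard_isEisensteinTuple, hcardQuot, hsq, Submodule.bot_coe,
    Set.ncard_sdiff_singleton_of_mem m.zero_mem, Set.ncard_compl, hcardS, hcardIdeal, sq N,
    ← Nat.mul_sub_one]
  ring

theorem ncard_compl_localSet_map_mk_div_card [Module.Finite ℤ R] {d : ℕ} (hd : 2 ≤ d)
    (P : HeightOneSpectrum R) :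
    ((localSet d (P.asIdeal.map (Ideal.Quotient.mk (P.asIdeal ^ 2))))ᶜ.ncard : ℝ) /
      Nat.card (Fin (d + 1) → R ⧸ P.asIdeal ^ 2) = 1 - localDensity d P.asIdeal := by
  set T := localSet d (P.asIdeal.map (Ideal.Quotient.mk (P.asIdeal ^ 2)))
  have hN := one_lt_absNorm P
  have : Finite (R ⧸ P.asIdeal ^ 2) :=
    Ideal.finiteQuotientOfFreeOfNeBot _ (pow_ne_zero 2 P.ne_bot)
  have hcard : Nat.card (Fin (d + 1) → R ⧸ P.asIdeal ^ 2) =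
      Ideal.absNorm P.asIdeal ^ (d + 1) * Ideal.absNorm P.asIdeal ^ (d + 1) := by
    rw [Nat.card_fun, natCard_quotient, map_pow, Nat.card_fin, ← mul_pow, sq]
  have hcompl : (Tᶜ.ncard : ℝ) = Nat.card (Fin (d + 1) → R ⧸ P.asIdeal ^ 2) - T.ncard :=
    eq_sub_of_add_eq' (by exact_mod_cast T.ncard_add_ncard_compl)
  have : (Ideal.absNorm P.asIdeal : ℝ) ≠ 0 := by positivity
  rw [hcompl, ncard_localSet_map_mk hd P, hcard, localDensity]
  push_cast [Nat.cast_sub hN.le]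
  field_simp

theorem tendsto_proportion_compl_biUnion_localSet {ι : Type*} [Fintype ι]
    {b : Module.Basis ι ℤ R} {d : ℕ} (hd : 2 ≤ d) (S : Finset (HeightOneSpectrum R)) :
    Tendsto (fun H => proportion (tupleCube b (d + 1) H) (⋃ P ∈ S, localSet d P.asIdeal)ᶜ) atTop
      (𝓝 (∏ P ∈ S, (1 - localDensity d P.asIdeal))) := by
  have := Module.Finite.of_basis b
  let G (P : S) := Fin (d + 1) → R ⧸ P.1.asIdeal ^ 2
  have (P : S) : Finite (R ⧸ P.1.asIdeal ^ 2) :=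
    Ideal.finiteQuotientOfFreeOfNeBot _ (pow_ne_zero 2 P.1.ne_bot)
  let f : (Fin (d + 1) → R) →+ ∀ P, G P := AddMonoidHom.pi fun P =>
    (Ideal.Quotient.mk (P.1.asIdeal ^ 2)).toAddMonoidHom.compLeft (Fin (d + 1))
  let T (P : S) : Set (G P) :=
    (localSet d (P.1.asIdeal.map (Ideal.Quotient.mk (P.1.asIdeal ^ 2))))ᶜ
  have hf : Function.Surjective f := by
    intro g
    have hcrt (i : Fin (d + 1)) : ∃ x, ∀ P, ∀ hP : P ∈ S,
        x - (g ⟨P, hP⟩ i).out ∈ P.asIdeal ^ 2 :=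
      IsDedekindDomain.exists_forall_sub_mem_ideal HeightOneSpectrum.asIdeal (fun _ => 2)
        (fun P _ => P.prime) (fun P _ Q _ => HeightOneSpectrum.ext_iff.not.1) fun P => (g P i).out
    choose x hx using hcrt
    refine ⟨x, funext fun P => funext fun i => ?_⟩
    exact (Ideal.Quotient.eq.2 (hx i P.1 P.2)).trans (Ideal.Quotient.mk_out _)
  have hpre : (⋃ P ∈ S, localSet d P.asIdeal)ᶜ = f ⁻¹' Set.univ.pi T := by
    ext a
    have h (P : S) : f a P ∈ T P ↔ a ∉ localSet d P.1.asIdeal :=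
      (comp_mem_localSet_iff Ideal.Quotient.mk_surjective (Ideal.mk_ker (I := _)).le).not
    simp [h]
  have hlim := tendsto_proportion_cube_preimage
    (b := Pi.basis fun _ : Fin (d + 1) => b) hf (Set.univ.pi T)
  rw [hpre]
  convert hlim using 2
  rw [ncard_univ_pi, Nat.card_pi, Nat.cast_prod, Nat.cast_prod, ← Finset.prod_div_distrib,
    ← Finset.prod_coe_sort S]
  exact Finset.prod_congr rfl fun P _ => (ncard_compl_localSet_map_mk_div_card hd P.1).symm

end LocalDensity

section SumsOverPrimes

open Filter Topology IsDedekindDomain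

theorem summable_comp_iff_of_finite_fibers {α β : Type*} {f : α → β}
    (hf : ∀ y, (f ⁻¹' {y}).Finite) {g : β → ℝ} (hg : ∀ y, 0 ≤ g y) :
    Summable (g ∘ f) ↔ Summable fun y => Nat.card {x // f x = y} * g y := by
  have (y : β) : Finite {x // f x = y} := (hf y).to_subtype
  have hfiber (y : β) : ((fun x : {x // f x = y} => g (f x)) : _ → ℝ) = fun _ => g y :=
    funext fun x => congrArg g x.2
  rw [← (Equiv.sigmaFiberEquiv f).summable_iff,
    summable_sigma_of_nonneg (f := (g ∘ f) ∘ Equiv.sigmaFiberEquiv f) fun _ => hg _]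
  simp only [Function.comp_apply, Equiv.sigmaFiberEquiv, Equiv.coe_fn_mk]
  simp only [hfiber, tsum_const, nsmul_eq_mul, Summable.of_finite, implies_true, true_and]

variable (K : Type*) [Field K] [NumberField K]

theorem summable_comp_absNorm_iff {g : ℕ → ℝ} (hg : ∀ n, 0 ≤ g n) :
    (Summable fun I : Ideal (𝓞 K) => g (Ideal.absNorm I)) ↔
      Summable fun n => Nat.card {I : Ideal (𝓞 K) // Ideal.absNorm I = n} * g n :=
  summable_comp_iff_of_finite_fibers (fun n => Ideal.finite_setOfPred_absNorm_eq n) hg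

theorem not_summable_inv_absNorm_ideal :
    ¬ Summable fun I : Ideal (𝓞 K) => (Ideal.absNorm I : ℝ)⁻¹ := by
  rw [summable_comp_absNorm_iff K (g := fun n => (n : ℝ)⁻¹) fun n => by positivity]
  intro hsum
  have hbound : ∀ s : ℝ, 1 < s → ‖dedekindZeta K s‖ ≤
      ∑' n : ℕ, (Nat.card {I : Ideal (𝓞 K) // Ideal.absNorm I = n} : ℝ) * (n : ℝ)⁻¹ := by
    intro s hs
    refine tsum_of_norm_bounded hsum.hasSum fun n => ?_
    rw [LSeries.norm_term_eq]
    split_ifs with hn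
    · positivity
    · rw [← div_eq_mul_inv, Complex.norm_natCast, Complex.ofReal_re]
      gcongr
      exact Real.self_le_rpow_of_one_le (by exact_mod_cast Nat.one_le_iff_ne_zero.2 hn) hs.le
  have hsub : Tendsto (fun s : ℝ => (s : ℂ) - 1) (𝓝[>] 1) (𝓝 0) := by
    have h : Continuous fun s : ℝ => (s : ℂ) - 1 := by fun_prop
    simpa using (h.tendsto 1).mono_left nhdsWithin_le_nhds
  have hzero : Tendsto (fun s : ℝ => ((s : ℂ) - 1) * dedekindZeta K s) (𝓝[>] 1) (𝓝 0) :=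
    hsub.zero_mul_isBoundedUnder_le
      (isBoundedUnder_of_eventually_le (eventually_mem_nhdsWithin.mono hbound))
  have hresidue := tendsto_nhds_unique hzero (tendsto_sub_one_mul_dedekindZeta_nhdsGT K)
  exact dedekindZeta_residue_ne_zero K (by exact_mod_cast hresidue.symm)

theorem summable_inv_absNorm_sq_ideal :
    Summable fun I : Ideal (𝓞 K) => ((Ideal.absNorm I : ℝ) ^ 2)⁻¹ := by
  rw [summable_comp_absNorm_iff K (g := fun n => ((n : ℝ) ^ 2)⁻¹) fun n => by positivity]
  have hne : ∀ᶠ s : ℝ in 𝓝[>] 1, ((s : ℂ) - 1) * dedekindZeta K s ≠ 0 :=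
    (tendsto_sub_one_mul_dedekindZeta_nhdsGT K).eventually_ne
      (by exact_mod_cast dedekindZeta_residue_ne_zero K)
  obtain ⟨s, hs, -, hs2⟩ := (hne.and (Ioo_mem_nhdsGT one_lt_two)).exists
  have hsum : LSeriesSummable (fun n => (Nat.card {I : Ideal (𝓞 K) // Ideal.absNorm I = n} : ℂ))
      s := by
    by_contra h
    exact hs (mul_eq_zero_of_right _ (tsum_eq_zero_of_not_summable h))
  refine (hsum.of_re_le_re (s' := 2) (by simpa using hs2.le)).norm.congr fun n => ?_
  rw [LSeries.norm_term_eq]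
  split_ifs with hn
  · simp [hn]
  · simp [div_eq_mul_inv]

theorem summable_inv_absNorm_sq :
    Summable fun P : HeightOneSpectrum (𝓞 K) => ((Ideal.absNorm P.asIdeal : ℝ) ^ 2)⁻¹ :=
  (summable_inv_absNorm_sq_ideal K).comp_injective fun _ _ => HeightOneSpectrum.ext

theorem surjective_prod_mul_sq {R : Type*} [CommRing R] [IsDedekindDomain R] :
    Function.Surjective fun p : Finset (HeightOneSpectrum R) × Ideal R =>
      (∏ P ∈ p.1, P.asIdeal) * p.2 ^ 2 := by
  classical
  intro I
  induction I using UniqueFactorizationMonoid.induction_on_prime with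
  | h₁ => exact ⟨(∅, 0), by simp⟩
  | h₂ I hI => exact ⟨(∅, 1), by simp [Ideal.isUnit_iff.1 hI, ← Ideal.one_eq_top]⟩
  | h₃ I Q _ hQ ih =>
    obtain ⟨⟨s, L⟩, rfl⟩ := ih
    let P : HeightOneSpectrum R := ⟨Q, Ideal.isPrime_of_prime hQ, hQ.ne_zero⟩
    by_cases hP : P ∈ s
    · refine ⟨(s.erase P, Q * L), ?_⟩
      dsimp only
      rw [← Finset.mul_prod_erase s _ hP]
      ring
    · refine ⟨(insert P s, L), ?_⟩
      dsimp only
      rw [Finset.prod_insert hP, mul_assoc]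

theorem not_summable_inv_absNorm :
    ¬ Summable fun P : HeightOneSpectrum (𝓞 K) => (Ideal.absNorm P.asIdeal : ℝ)⁻¹ := by
  intro hsum
  let m (p : Finset (HeightOneSpectrum (𝓞 K)) × Ideal (𝓞 K)) : Ideal (𝓞 K) :=
    (∏ P ∈ p.1, P.asIdeal) * p.2 ^ 2
  have hm : Summable fun p => (Ideal.absNorm (m p) : ℝ)⁻¹ := by
    refine (Summable.mul_of_nonneg
      (summable_finsetProd_of_summable_nonneg (fun _ => by positivity) hsum)
      (summable_inv_absNorm_sq_ideal K) (fun _ => ?_) fun _ => ?_).congr fun p => ?_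
    · exact Finset.prod_nonneg fun _ _ => by positivity
    · exact inv_nonneg.2 (sq_nonneg _)
    · simp [m, mul_comm]
  refine not_summable_inv_absNorm_ideal K
    ((hm.comp_injective (Function.injective_surjInv surjective_prod_mul_sq)).congr fun I => ?_)
  simp only [Function.comp_apply]
  exact congrArg (fun J => (Ideal.absNorm J : ℝ)⁻¹) (Function.surjInv_eq surjective_prod_mul_sq I)

theorem not_summable_localDensity_two :
    ¬ Summable fun P : HeightOneSpectrum (𝓞 K) => localDensity 2 P.asIdeal := by
  refine fun hsum => not_summable_inv_absNorm K
    (Summable.of_nonneg_of_le (fun _ => by positivity) (fun P => ?_) (hsum.mul_left 4))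
  have hN : (2 : ℝ) ≤ Ideal.absNorm P.asIdeal := by exact_mod_cast one_lt_absNorm P
  rw [localDensity, inv_eq_one_div, mul_div_assoc', div_le_div_iff₀ (by positivity) (by positivity)]
  calc 1 * (Ideal.absNorm P.asIdeal : ℝ) ^ 3
      = (Ideal.absNorm P.asIdeal : ℝ) ^ 2 * Ideal.absNorm P.asIdeal := by ring
    _ ≤ 4 * ((Ideal.absNorm P.asIdeal : ℝ) - 1) ^ 2 * Ideal.absNorm P.asIdeal := by
        gcongr
        nlinarith

end SumsOverPrimes

section LeadingDisc

variable {R : Type*} [CommRing R] {e : ℕ}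

/-- For a polynomial `f` of degree `e + 3` with coefficients `a 0, t 0, …, t (e + 2)`, the
discriminant of the quadratic `(e + 1)`-st derivative of `f`, up to a constant factor. It vanishes
modulo every `P` for which `f` is congruent to some `u * (X + C c) ^ (e + 3)`. -/
def leadingDisc (t : Fin (e + 3) → R) : R :=
  ((e + 2 : ℕ) : R) * t ⟨e + 1, by omega⟩ ^ 2 -
    ((2 * (e + 3) : ℕ) : R) * (t (Fin.last _) * t ⟨e, by omega⟩)

theorem leadingDisc_tail_mem {P : Ideal R} {a : Fin (e + 3 + 1) → R}
    (ha : a ∈ localSet (e + 3) P) : leadingDisc (Fin.tail a) ∈ P := by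
  obtain ⟨u, c, -, h⟩ := exists_quotient_mk_eq_of_mem_localSet ha
  have h1 := h (Fin.last _)
  have h2 := h ⟨e + 2, by omega⟩
  have h3 := h ⟨e + 1, by omega⟩
  have hchoose : (2 : R ⧸ P) * (e + 3).choose (e + 1) = (e + 3) * (e + 2) := by
    have : 2 * (e + 3).choose (e + 1) = (e + 3) * (e + 2) := by
      rw [Nat.choose_symm_of_eq_add (show e + 3 = (e + 1) + 2 by omega), mul_comm,
        Nat.choose_two_right, Nat.div_mul_cancel (Nat.even_mul_pred_self _).two_dvd]
      rfl
    exact_mod_cast congrArg (Nat.cast (R := R ⧸ P)) this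
  simp only [Fin.val_last, Nat.choose_self, Nat.sub_self, pow_zero, mul_one, Nat.cast_one,
    Nat.choose_succ_self_right, show e + 3 - (e + 2) = 1 by omega, pow_one,
    show e + 3 - (e + 1) = 2 by omega] at h1 h2 h3
  rw [← Ideal.Quotient.eq_zero_iff_mem]
  simp only [leadingDisc, Fin.tail, Fin.succ_last, Fin.succ_mk, map_sub, map_mul, map_pow,
    map_natCast]
  rw [h1, h2, h3]
  push_cast
  linear_combination (-(e : R ⧸ P) - 3) * u ^ 2 * c ^ 2 * hchoose

theorem mk_apply_zero_eq_of_mem_localSet {P : Ideal R} [P.IsPrime]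
    (he : ((e + 2 : ℕ) : R) ∉ P) {a b : Fin (e + 2 + 1) → R} (ha : a ∈ localSet (e + 2) P)
    (hb : b ∈ localSet (e + 2) P) (hab : Fin.tail a = Fin.tail b) :
    Ideal.Quotient.mk P (a 0) = Ideal.Quotient.mk P (b 0) := by
  obtain ⟨u, c, hu, h⟩ := exists_quotient_mk_eq_of_mem_localSet ha
  obtain ⟨v, w, -, k⟩ := exists_quotient_mk_eq_of_mem_localSet hb
  have hsucc (i : Fin (e + 2)) := (h i.succ).symm.trans
    ((congrArg (Ideal.Quotient.mk P) (congrFun hab i)).trans (k i.succ))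
  have huv : u = v := by simpa using hsucc (Fin.last _)
  have hcw := hsucc ⟨e, by omega⟩
  simp only [Fin.val_succ, show e + 2 - (e + 1) = 1 by omega, pow_one,
    Nat.choose_succ_self_right, ← huv] at hcw
  have he' : ((e + 2 : ℕ) : R ⧸ P) ≠ 0 := by
    rwa [← map_natCast (Ideal.Quotient.mk P), Ne, Ideal.Quotient.eq_zero_iff_mem]
  rw [h 0, k 0, ← huv, mul_left_cancel₀ he' (mul_left_cancel₀ hu hcw)]

end LeadingDisc

section LargePrimes

open IsDedekindDomain

variable {R ι : Type*} [CommRing R] [Fintype ι] {b : Module.Basis ι ℤ R} {H e : ℕ}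

/-- A prime `P` is large relative to `H` if two distinct integers in `[-H, H]` are never congruent
modulo `P`. -/
def IsLarge (H : ℕ) (P : Ideal R) : Prop :=
  ∀ n : ℤ, |n| ≤ 2 * H → (n : R) ∈ P → n = 0

theorem IsLarge.natCast_notMem {P : Ideal R} (hP : IsLarge H P) {n : ℕ} (hn : n ≠ 0)
    (hnH : n ≤ 2 * H) : (n : R) ∉ P := fun h => by
  have := hP n (by rw [Nat.abs_cast]; exact_mod_cast hnH) (by simpa using h)
  omega

theorem IsLarge.proportion_fiber_le {P : Ideal R} [hprime : P.IsPrime] (hP : IsLarge H P)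
    (g : R ⧸ P) : proportion (cube b H) {x | Ideal.Quotient.mk P x = g} ≤ (2 * H : ℝ)⁻¹ := by
  obtain ⟨j, hj⟩ : ∃ j, b j ∉ P := by
    by_contra! h
    refine hprime.ne_top ((Ideal.eq_top_iff_one _).2 ?_)
    rw [← b.sum_repr 1]
    exact Ideal.sum_mem _ fun i _ => zsmul_mem (h i) _
  refine proportion_fiber_le_inv (f := (Ideal.Quotient.mk P : R →+ R ⧸ P)) j
    (fun n hn h => hP n hn.le ?_) g
  rw [AddMonoidHom.coe_coe, ← map_zsmul, Ideal.Quotient.eq_zero_iff_mem, zsmul_eq_mul] at h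
  exact (hprime.mem_or_mem h).resolve_right hj

theorem IsLarge.proportion_cons_mem_localSet_le {P : HeightOneSpectrum R}
    (hP : IsLarge H P.asIdeal) (he : e + 2 ≤ 2 * H) (t : Fin (e + 2) → R) :
    proportion (cube b H) {x | Fin.cons x t ∈ localSet (e + 2) P.asIdeal} ≤ (2 * H : ℝ)⁻¹ := by
  have := P.isPrime
  by_cases h : ∃ x, Fin.cons x t ∈ localSet (e + 2) P.asIdeal
  · obtain ⟨x₀, hx₀⟩ := h
    refine (proportion_mono fun x _ hx => ?_).trans
      (hP.proportion_fiber_le (Ideal.Quotient.mk P.asIdeal x₀))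
    exact mk_apply_zero_eq_of_mem_localSet (hP.natCast_notMem (by omega) he) hx hx₀ (by simp)
  · have hempty : {x | Fin.cons x t ∈ localSet (e + 2) P.asIdeal} = ∅ :=
      Set.eq_empty_of_forall_notMem fun x hx => h ⟨x, hx⟩
    rw [hempty, proportion_empty]
    positivity

/-- The coefficient tuples of the polynomials of degree `d` which are shifted `P`-Eisenstein for
some prime `P` that is large relative to `H`. -/
def largeLocalSet (R : Type*) [CommRing R] (d H : ℕ) : Set (Fin (d + 1) → R) :=
  {a | ∃ P : HeightOneSpectrum R, IsLarge H P.asIdeal ∧ a ∈ localSet d P.asIdeal}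

theorem eq_of_leadingDisc_eq_zero [IsDomain R] (he : e + 3 ≤ H) {a a' : Fin (e + 3 + 1) → R}
    (ha : a ∈ largeLocalSet R (e + 3) H) (hdisc : leadingDisc (Fin.tail a) = 0)
    (hdisc' : leadingDisc (Fin.tail a') = 0) (h : ∀ i ≠ ⟨e + 1, by omega⟩, a i = a' i) :
    a = a' := by
  obtain ⟨P, hP, haP⟩ := ha
  have hne : ((2 * (e + 3) : ℕ) : R) ≠ 0 := fun h0 =>
    hP.natCast_notMem (n := 2 * (e + 3)) (by omega) (by omega) (by rw [h0]; exact zero_mem _)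
  have h1 := h ⟨e + 2, by omega⟩ (by simp)
  have h2 := h (Fin.last _) (by simp [Fin.ext_iff])
  simp only [leadingDisc, Fin.tail, Fin.succ_mk, Fin.succ_last] at hdisc hdisc'
  rw [← h1, ← h2] at hdisc'
  funext i
  rcases eq_or_ne i ⟨e + 1, by omega⟩ with rfl | hi
  · refine mul_left_cancel₀ (last_ne_zero_of_mem_localSet haP) (mul_left_cancel₀ hne ?_)
    linear_combination hdisc' - hdisc
  · exact h i hi

theorem proportion_largeLocalSet_leadingDisc_eq_zero_le [IsDomain R] (he : e + 3 ≤ H) :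
    proportion (tupleCube b (e + 3 + 1) H)
      {a ∈ largeLocalSet R (e + 3) H | leadingDisc (Fin.tail a) = 0} ≤ (2 * H : ℝ)⁻¹ := by
  obtain ⟨j₀⟩ := b.index_nonempty
  refine proportion_cube_le_inv_of_coord_determined ⟨⟨e + 1, by omega⟩, j₀⟩
    fun a _ a' _ ha ha' h => ?_
  refine eq_of_leadingDisc_eq_zero he ha.1 ha.2 ha'.2 fun i hi => b.repr.injective ?_
  ext j
  simpa using h ⟨i, j⟩ (by simp [hi])

theorem exists_abs_repr_mul_le (b : Module.Basis ι ℤ R) :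
    ∃ A : ℤ, ∀ H : ℕ, ∀ x ∈ cube b H, ∀ y ∈ cube b H, ∀ i, |b.repr (x * y) i| ≤ A * H ^ 2 := by
  refine ⟨∑ i, ∑ j, ∑ l, |b.repr (b j * b l) i|, fun H x hx y hy i => ?_⟩
  have hcoord {z : R} (hz : z ∈ cube b H) (j : ι) : |b.repr z j| ≤ H :=
    abs_le.2 ⟨(mem_cube.1 hz j).1, (mem_cube.1 hz j).2.le⟩
  have hexpand : b.repr (x * y) i =
      ∑ j, ∑ l, b.repr x j * b.repr y l * b.repr (b j * b l) i := by
    conv_lhs => rw [← b.sum_repr x, ← b.sum_repr y]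
    rw [Finset.sum_mul_sum]
    simp only [smul_mul_smul_comm, map_sum, map_smul, Finsupp.coe_finsetSum, Finset.sum_apply,
      Finsupp.smul_apply, smul_eq_mul]
  calc |b.repr (x * y) i|
      ≤ ∑ j, ∑ l, |b.repr x j * b.repr y l * b.repr (b j * b l) i| := by
        rw [hexpand]
        exact (Finset.abs_sum_le_sum_abs _ _).trans
          (Finset.sum_le_sum fun j _ => Finset.abs_sum_le_sum_abs _ _)
    _ ≤ ∑ j, ∑ l, H * H * |b.repr (b j * b l) i| := by
        gcongr with j _ l _
        rw [abs_mul, abs_mul]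
        gcongr
        exacts [hcoord hx j, hcoord hy l]
    _ = (∑ j, ∑ l, |b.repr (b j * b l) i|) * H ^ 2 := by
        simp_rw [← Finset.mul_sum]
        ring
    _ ≤ _ := by
        refine mul_le_mul_of_nonneg_right ?_ (by positivity)
        exact Finset.single_le_sum (f := fun i => ∑ j, ∑ l, |b.repr (b j * b l) i|)
          (fun _ _ => by positivity) (Finset.mem_univ i)

theorem exists_natAbs_norm_leadingDisc_le [IsDomain R] (b : Module.Basis ι ℤ R) (e : ℕ) :
    ∃ C : ℕ, ∀ H : ℕ, ∀ t ∈ tupleCube b (e + 3) H,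
      (Algebra.norm ℤ (leadingDisc t)).natAbs ≤ C * H ^ (2 * Fintype.card ι) := by
  classical
  obtain ⟨A, hA⟩ := exists_abs_repr_mul_le b
  let B : ℤ := (e + 2) * A + 2 * (e + 3) * A
  refine ⟨(ClassGroup.normBound AbsoluteValue.abs b * B ^ Fintype.card ι).natAbs,
    fun H t ht => ?_⟩
  have hrepr (i : ι) : |b.repr (leadingDisc t) i| ≤ B * H ^ 2 := by
    have hmem := mem_tupleCube.1 ht
    rw [leadingDisc, ← nsmul_eq_mul, ← nsmul_eq_mul, sq, map_sub, map_nsmul, map_nsmul]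
    simp only [Finsupp.sub_apply, Finsupp.smul_apply, nsmul_eq_mul]
    refine (abs_sub _ _).trans ?_
    rw [abs_mul, abs_mul, Nat.abs_cast, Nat.abs_cast]
    calc _ ≤ ((e + 2 : ℕ) : ℤ) * (A * H ^ 2) + ((2 * (e + 3) : ℕ) : ℤ) * (A * H ^ 2) := by
          gcongr <;> exact hA H _ (hmem _) _ (hmem _) i
      _ = B * H ^ 2 := by push_cast; ring
  have hnorm := ClassGroup.norm_le AbsoluteValue.abs b _ hrepr
  rw [mul_pow, ← pow_mul, ← mul_assoc, AbsoluteValue.abs_apply] at hnorm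
  zify
  exact hnorm.trans (by gcongr; exact le_abs_self _)

variable [IsDedekindDomain R]

theorem prod_absNorm_le_natAbs_norm [Module.Free ℤ R] [Module.Finite ℤ R] {x : R} (hx : x ≠ 0)
    {S : Finset (HeightOneSpectrum R)} (hS : ∀ P ∈ S, x ∈ P.asIdeal) :
    ∏ P ∈ S, Ideal.absNorm P.asIdeal ≤ (Algebra.norm ℤ x).natAbs := by
  have hdvd : ∏ P ∈ S, P.asIdeal ∣ Ideal.span {x} := by
    refine Finset.prod_dvd_of_coprime (fun P _ Q _ hPQ => ?_) fun P hP => ?_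
    · simpa using HeightOneSpectrum.isCoprime_pow_of_ne P Q hPQ 1 1
    · rw [Ideal.dvd_iff_le, Ideal.span_singleton_le_iff_mem]
      exact hS P hP
  have h := map_dvd Ideal.absNorm hdvd
  rw [Ideal.absNorm_span_singleton, map_prod] at h
  exact Nat.le_of_dvd (Int.natAbs_pos.2 (Algebra.norm_ne_zero_iff.2 hx)) h

theorem IsLarge.two_mul_le_absNorm [Module.Free ℤ R] [Module.Finite ℤ R]
    {P : HeightOneSpectrum R} (hP : IsLarge H P.asIdeal) : 2 * H ≤ Ideal.absNorm P.asIdeal := by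
  by_contra! h
  exact hP.natCast_notMem (zero_lt_one.trans (one_lt_absNorm P)).ne' h.le (Ideal.absNorm_mem _)

theorem eventually_card_le_of_leadingDisc_mem (b : Module.Basis ι ℤ R) (e : ℕ) :
    ∀ᶠ H : ℕ in Filter.atTop, ∀ t ∈ tupleCube b (e + 3) H, leadingDisc t ≠ 0 →
      ∀ S : Finset (HeightOneSpectrum R),
        (∀ P ∈ S, IsLarge H P.asIdeal ∧ leadingDisc t ∈ P.asIdeal) →
          S.card ≤ 2 * Fintype.card ι := by
  have := Module.Free.of_basis b
  have := Module.Finite.of_basis b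
  obtain ⟨C, hC⟩ := exists_natAbs_norm_leadingDisc_le b e
  filter_upwards [Filter.eventually_gt_atTop C] with H hH t ht ht0 S hS
  by_contra! hcard
  have hH0 : 0 < H := by omega
  refine lt_irrefl (H * H ^ (2 * Fintype.card ι)) ?_
  calc H * H ^ (2 * Fintype.card ι) ≤ (2 * H) ^ (2 * Fintype.card ι + 1) := by
        rw [← pow_succ']
        gcongr
        omega
    _ ≤ (2 * H) ^ S.card := Nat.pow_le_pow_right (by omega) hcard
    _ ≤ ∏ P ∈ S, Ideal.absNorm P.asIdeal :=
        Finset.pow_card_le_prod _ _ _ fun P hP => (hS P hP).1.two_mul_le_absNorm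
    _ ≤ (Algebra.norm ℤ (leadingDisc t)).natAbs :=
        prod_absNorm_le_natAbs_norm ht0 fun P hP => (hS P hP).2
    _ ≤ C * H ^ (2 * Fintype.card ι) := hC H t ht
    _ < H * H ^ (2 * Fintype.card ι) := by gcongr

theorem eventually_proportion_largeLocalSet_leadingDisc_ne_zero_le (b : Module.Basis ι ℤ R)
    (e : ℕ) : ∀ᶠ H : ℕ in Filter.atTop, proportion (tupleCube b (e + 3 + 1) H)
      {a ∈ largeLocalSet R (e + 3) H | leadingDisc (Fin.tail a) ≠ 0} ≤
        2 * Fintype.card ι * (2 * H : ℝ)⁻¹ := by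
  filter_upwards [eventually_card_le_of_leadingDisc_mem b e, Filter.eventually_ge_atTop (e + 3)]
    with H hcard hH
  refine proportion_tupleCube_succ_le (by positivity) fun t ht => ?_
  by_cases ht0 : leadingDisc t = 0
  · have hempty : {x : R | (Fin.cons x t : Fin (e + 3 + 1) → R) ∈
        {a ∈ largeLocalSet R (e + 3) H | leadingDisc (Fin.tail a) ≠ 0}} = ∅ :=
      Set.eq_empty_of_forall_notMem fun x hx => hx.2 (by rwa [Fin.tail_cons])
    rw [hempty, proportion_empty]
    positivity
  have hspan : Ideal.span {leadingDisc t} ≠ ⊥ := by rwa [Ne, Ideal.span_singleton_eq_bot]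
  have hfin : {P : HeightOneSpectrum R | IsLarge H P.asIdeal ∧ leadingDisc t ∈ P.asIdeal}.Finite :=
    (Ideal.finite_factors hspan).subset fun P hP =>
      Ideal.dvd_iff_le.2 ((Ideal.span_singleton_le_iff_mem _).2 hP.2)
  have hS : ∀ P ∈ hfin.toFinset, IsLarge H P.asIdeal ∧ leadingDisc t ∈ P.asIdeal :=
    fun P hP => hfin.mem_toFinset.1 hP
  calc _ ≤ proportion (cube b H) (⋃ P ∈ hfin.toFinset,
          {x | (Fin.cons x t : Fin (e + 3 + 1) → R) ∈ localSet (e + 3) P.asIdeal}) := by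
        refine proportion_mono fun x _ hx => ?_
        obtain ⟨⟨P, hP, hxP⟩, -⟩ := hx
        have hdisc := leadingDisc_tail_mem hxP
        rw [Fin.tail_cons] at hdisc
        exact Set.mem_biUnion (hfin.mem_toFinset.2 ⟨hP, hdisc⟩) hxP
    _ ≤ hfin.toFinset.card • (2 * H : ℝ)⁻¹ :=
        (proportion_biUnion_le _ _).trans (Finset.sum_le_card_nsmul _ _ _ fun P hP =>
          (hS P hP).1.proportion_cons_mem_localSet_le (by omega) t)
    _ ≤ 2 * Fintype.card ι * (2 * H : ℝ)⁻¹ := by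
        rw [nsmul_eq_mul]
        gcongr
        exact_mod_cast hcard t ht ht0 _ hS

theorem tendsto_proportion_largeLocalSet (b : Module.Basis ι ℤ R) (e : ℕ) :
    Filter.Tendsto (fun H => proportion (tupleCube b (e + 3 + 1) H) (largeLocalSet R (e + 3) H))
      Filter.atTop (nhds 0) := by
  have hinv : Filter.Tendsto (fun H : ℕ => (2 * H : ℝ)⁻¹) Filter.atTop (nhds 0) :=
    (tendsto_natCast_atTop_atTop.const_mul_atTop two_pos).inv_tendsto_atTop
  have hlim : Filter.Tendsto (fun H : ℕ => 2 * Fintype.card ι * (2 * H : ℝ)⁻¹ + (2 * H : ℝ)⁻¹)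
      Filter.atTop (nhds 0) := by
    simpa using (hinv.const_mul (2 * Fintype.card ι : ℝ)).add hinv
  refine tendsto_of_tendsto_of_tendsto_of_le_of_le' tendsto_const_nhds hlim
    (.of_forall fun _ => proportion_nonneg) ?_
  filter_upwards [eventually_proportion_largeLocalSet_leadingDisc_ne_zero_le b e,
    Filter.eventually_ge_atTop (e + 3)] with H hne hH
  refine le_trans (proportion_mono fun a _ ha => ?_) (proportion_union_le.trans
    (add_le_add hne (proportion_largeLocalSet_leadingDisc_eq_zero_le hH)))
  by_cases hdisc : leadingDisc (Fin.tail a) = 0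
  exacts [Or.inr ⟨ha, hdisc⟩, Or.inl ⟨ha, hdisc⟩]

end LargePrimes

section Tail

open Filter Topology IsDedekindDomain

variable {R ι : Type*} [CommRing R] [Fintype ι] {b : Module.Basis ι ℤ R}

/-- The coefficient tuples over `A` of the polynomials `u * (X + C c) ^ d`. -/
def powerTuples (A : Type*) [CommRing A] (d : ℕ) : Set (Fin (d + 1) → A) :=
  Set.range fun (p : A × A) i => p.1 * (d.choose i * p.2 ^ (d - i : ℕ))

theorem mk_comp_mem_powerTuples {d : ℕ} {P : Ideal R} {a : Fin (d + 1) → R}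
    (ha : a ∈ localSet d P) : Ideal.Quotient.mk P ∘ a ∈ powerTuples (R ⧸ P) d := by
  obtain ⟨u, c, -, h⟩ := exists_quotient_mk_eq_of_mem_localSet ha
  exact ⟨(u, c), funext fun i => (h i).symm⟩

theorem ncard_powerTuples_le (A : Type*) [CommRing A] [Finite A] (d : ℕ) :
    (powerTuples A d).ncard ≤ Nat.card A ^ 2 := by
  rw [powerTuples, ← Set.image_univ, sq, ← Nat.card_prod, ← Set.ncard_univ]
  exact Set.ncard_image_le

variable [IsDedekindDomain R] [Module.Free ℤ R]

theorem proportion_localSet_le_of_not_isLarge {d H : ℕ} {P : HeightOneSpectrum R} (hd : 3 ≤ d)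
    (hP : ¬ IsLarge H P.asIdeal) :
    proportion (tupleCube b (d + 1) H) (localSet d P.asIdeal) ≤
      2 ^ ((d + 1) * Fintype.card ι) * ((Ideal.absNorm P.asIdeal : ℝ) ^ 2)⁻¹ := by
  have := Module.Finite.of_basis b
  obtain ⟨n, hnH, hnP, hn⟩ : ∃ n : ℤ, |n| ≤ 2 * H ∧ (n : R) ∈ P.asIdeal ∧ n ≠ 0 := by
    simpa [IsLarge] using hP
  rw [Int.abs_eq_natAbs] at hnH
  have : NeZero n.natAbs := ⟨Int.natAbs_ne_zero.2 hn⟩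
  have : Finite (R ⧸ P.asIdeal) := Ideal.finiteQuotientOfFreeOfNeBot _ P.ne_bot
  have hN : (1 : ℝ) ≤ Ideal.absNorm P.asIdeal := by exact_mod_cast (one_lt_absNorm P).le
  have hkill (g : Fin (d + 1) → R ⧸ P.asIdeal) : n.natAbs • g = 0 := by
    have hn0 : (n : R ⧸ P.asIdeal) = 0 := by
      simpa using Ideal.Quotient.eq_zero_iff_mem.2 hnP
    rw [natAbs_nsmul_eq_zero]
    ext i
    rw [Pi.smul_apply, zsmul_eq_mul, hn0, zero_mul, Pi.zero_apply]
  let f := (Ideal.Quotient.mk P.asIdeal).toAddMonoidHom.compLeft (Fin (d + 1))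
  have hf : Function.Surjective f := Ideal.Quotient.mk_surjective.comp_left
  have hcard : Nat.card (Fin (d + 1) → R ⧸ P.asIdeal) = Ideal.absNorm P.asIdeal ^ (d + 1) := by
    rw [Nat.card_fun, Nat.card_fin, natCard_quotient]
  calc proportion (tupleCube b (d + 1) H) (localSet d P.asIdeal)
      ≤ proportion (tupleCube b (d + 1) H) (f ⁻¹' powerTuples (R ⧸ P.asIdeal) d) :=
        proportion_mono fun _ _ => mk_comp_mem_powerTuples
    _ ≤ 2 ^ ((d + 1) * Fintype.card ι) * ((powerTuples (R ⧸ P.asIdeal) d).ncard /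
          Nat.card (Fin (d + 1) → R ⧸ P.asIdeal)) := by
        simpa using proportion_cube_preimage_le (b := Pi.basis fun _ : Fin (d + 1) => b) hkill hf
          (powerTuples (R ⧸ P.asIdeal) d) (H := H) (by omega)
    _ ≤ 2 ^ ((d + 1) * Fintype.card ι) * ((Ideal.absNorm P.asIdeal : ℝ) ^ 2 /
          ((Ideal.absNorm P.asIdeal : ℝ) ^ 2 * (Ideal.absNorm P.asIdeal : ℝ) ^ 2)) := by
        rw [hcard, Nat.cast_pow, ← pow_add]
        gcongr ?_ * (?_ / ?_)
        · rw [← natCard_quotient]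
          exact_mod_cast ncard_powerTuples_le (R ⧸ P.asIdeal) d
        · exact pow_le_pow_right₀ hN (by omega)
    _ = _ := by rw [div_mul_cancel_left₀ (by positivity)]

theorem proportion_tail_le {d H : ℕ} (hd : 3 ≤ d)
    (hsum : Summable fun P : HeightOneSpectrum R => ((Ideal.absNorm P.asIdeal : ℝ) ^ 2)⁻¹)
    (S : Finset (HeightOneSpectrum R)) :
    proportion (tupleCube b (d + 1) H) (⋃ P ∉ S, localSet d P.asIdeal) ≤
      2 ^ ((d + 1) * Fintype.card ι) *
        ∑' P : {P // P ∉ S}, ((Ideal.absNorm P.1.asIdeal : ℝ) ^ 2)⁻¹ +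
      proportion (tupleCube b (d + 1) H) (largeLocalSet R d H) := by
  have hcover : (⋃ P ∉ S, localSet d P.asIdeal) ⊆
      (⋃ P : {P // P ∉ S}, {a ∈ localSet d P.1.asIdeal | ¬ IsLarge H P.1.asIdeal}) ∪
        largeLocalSet R d H := by
    intro a ha
    obtain ⟨P, hPS, ha⟩ := Set.mem_iUnion₂.1 ha
    by_cases hP : IsLarge H P.asIdeal
    · exact .inr ⟨P, hP, ha⟩
    · exact .inl (Set.mem_iUnion.2 ⟨⟨P, hPS⟩, ha, hP⟩)
  refine (proportion_mono fun a _ ha => hcover ha).trans (proportion_union_le.trans ?_)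
  gcongr
  rw [← tsum_mul_left]
  refine proportion_iUnion_le_tsum ((hsum.subtype _).mul_left _) fun P => ?_
  by_cases hP : IsLarge H P.1.asIdeal
  · simp only [hP, not_true_eq_false, and_false, Set.ofPred_false, proportion_empty]
    positivity
  · exact (proportion_mono fun a _ ha => ha.1).trans (proportion_localSet_le_of_not_isLarge hd hP)

theorem eventually_proportion_tail_le (b : Module.Basis ι ℤ R) {d : ℕ} (hd : 3 ≤ d)
    (hsum : Summable fun P : HeightOneSpectrum R => ((Ideal.absNorm P.asIdeal : ℝ) ^ 2)⁻¹)
    {ε : ℝ} (hε : 0 < ε) :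
    ∀ᶠ S : Finset (HeightOneSpectrum R) in atTop, ∀ᶠ H in atTop,
      proportion (tupleCube b (d + 1) H) (⋃ P ∉ S, localSet d P.asIdeal) ≤ ε := by
  have hsmall := (tendsto_tsum_compl_atTop_zero fun P : HeightOneSpectrum R =>
    ((Ideal.absNorm P.asIdeal : ℝ) ^ 2)⁻¹).const_mul (2 ^ ((d + 1) * Fintype.card ι) : ℝ)
  rw [mul_zero] at hsmall
  have hlarge : Tendsto (fun H => proportion (tupleCube b (d + 1) H) (largeLocalSet R d H)) atTop
      (𝓝 0) := by
    obtain ⟨e, rfl⟩ := Nat.exists_eq_add_of_le' hd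
    exact tendsto_proportion_largeLocalSet b e
  filter_upwards [hsmall.eventually_le_const (half_pos hε)] with S hS
  filter_upwards [hlarge.eventually_le_const (half_pos hε)] with H hH
  exact (proportion_tail_le hd hsum S).trans (by linarith)

end Tail

section NumberField

open Filter Topology IsDedekindDomain

variable (K : Type*) [Field K] [NumberField K]

theorem shiftedEisenstein_eq_iUnion (d : ℕ) :
    shiftedEisenstein K d = ⋃ P : HeightOneSpectrum (𝓞 K), localSet d P.asIdeal := by
  ext a
  simp only [shiftedEisenstein, Set.mem_ofPred_eq, Set.mem_iUnion, mem_localSet_iff]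
  exact ⟨fun ⟨h, P, hP, hP0, ha⟩ => ⟨⟨P, hP, hP0⟩, h, ha⟩,
    fun ⟨P, h, ha⟩ => ⟨h, P.asIdeal, P.isPrime, P.ne_bot, ha⟩⟩

theorem hasProd_one_sub_localDensity_two :
    HasProd (fun P : HeightOneSpectrum (𝓞 K) => 1 - localDensity 2 P.asIdeal) 0 :=
  hasProd_one_sub_zero_of_not_summable (localDensity_mem_Icc one_le_two)
    (not_summable_localDensity_two K)

variable {K}

theorem hasDensity_shiftedEisenstein {d : ℕ} (hd : 2 ≤ d) {p : ℝ}
    (hp : HasProd (fun P : HeightOneSpectrum (𝓞 K) => 1 - localDensity d P.asIdeal) p) :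
    HasDensity (shiftedEisenstein K d) (1 - p) := by
  intro E
  have hne : ∀ᶠ H in atTop, (tupleCube E (d + 1) H).Nonempty :=
    (eventually_gt_atTop 0).mono fun _ => cube_nonempty
  rw [hasDensityWrt_iff, ← tendsto_proportion_compl_iff hne, sub_sub_cancel,
    shiftedEisenstein_eq_iUnion]
  rcases hd.eq_or_lt with rfl | hd3
  · rw [hp.unique (hasProd_one_sub_localDensity_two K)]
    exact tendsto_proportion_compl_iUnion_of_hasProd_zero (hasProd_one_sub_localDensity_two K)
      (tendsto_proportion_compl_biUnion_localSet hd)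
  · exact tendsto_proportion_compl_iUnion hp (tendsto_proportion_compl_biUnion_localSet hd)
      fun ε => eventually_proportion_tail_le E hd3 (summable_inv_absNorm_sq K)

end NumberField

end EisensteinDensity

theorem corollary4p7 (K : Type*) [Field K] [NumberField K] (d : ℕ) (hd : 2 ≤ d) :
    Multipliable (fun P : IsDedekindDomain.HeightOneSpectrum (𝓞 K) =>
      (1 - ((Ideal.absNorm P.asIdeal : ℝ) - 1) ^ 2 / (Ideal.absNorm P.asIdeal : ℝ) ^ (d + 1) : ℝ)) ∧
    EisensteinDensity.HasDensity (EisensteinDensity.shiftedEisenstein K d)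
      (1 - ∏' P : IsDedekindDomain.HeightOneSpectrum (𝓞 K),
        (1 - ((Ideal.absNorm P.asIdeal : ℝ) - 1) ^ 2 /
          (Ideal.absNorm P.asIdeal : ℝ) ^ (d + 1) : ℝ)) ∧
    (d = 2 → EisensteinDensity.HasDensity (EisensteinDensity.shiftedEisenstein K d) 1) := by
  have hmul := EisensteinDensity.multipliable_one_sub_of_mem_Icc
    (EisensteinDensity.localDensity_mem_Icc (R := 𝓞 K) (one_le_two.trans hd))
  refine ⟨hmul, EisensteinDensity.hasDensity_shiftedEisenstein hd hmul.hasProd, ?_⟩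
  rintro rfl
  simpa only [sub_zero] using EisensteinDensity.hasDensity_shiftedEisenstein hd
    (EisensteinDensity.hasProd_one_sub_localDensity_two K)
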